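/- \textbf{Conventions.} For a pseudo-Riemannian metric $g$ (any signature) let $\mathrm{Rm}$, $\mathrm{Ric}$, $R$ be its Riemann, Ricci and scalar curvature, and $\Delta=\nabla^a\nabla_a$ its Laplacian. Fix $n\ge 3$. A \emph{scalar Riemannian invariant} $I$ is an $\mathbb R$-linear combination, with fixed real coefficients, of complete contractions of tensor products $\nabla^{N_1}\mathrm{Rm}\otimes\dots\otimes\nabla^{N_j}\mathrm{Rm}\otimes g^{\otimes q}$ (the empty product being the constant $1$); it assigns a function $I^g$ to every pseudo-Riemannian manifold of any dimension. It has \emph{weight} $w\in\mathbb R$ if $I^{c^2g}=c^wI^g$ for all pseudo-Riemannian $n$-manifolds $(M,g)$ and all constants $c>0$. Put $J:=R/(2(n-1))$, where $n$ is treated as a fixed number when $J$ is evaluated in other dimensions; in dimension $n$ this is the trace of the Schouten tensor. An $n$-manifold $(M,g)$ is \emph{Einstein} if $\mathrm{Ric}_g=2\lambda(n-1)g$ for a constant $\lambda\in\mathbb R$; for such a manifold and $\varepsilon>0$ with $|\lambda|\varepsilon\le1$ consider the $(n+2)$-dimensional pseudo-Riemannian manifold \[ \widetilde{\mathcal G}=(0,\infty)_t\times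 M\times(-\varepsilon,\varepsilon)_\rho,\qquad \widetilde g=2\rho\,dt^2+2t\,dt\,d\rho+\tau^2g,\qquad \tau=t(1+\lambda\rho), \] with projection $\pi:\widetilde{\mathcal G}\to M$. A scalar Riemannian invariant $I$ of weight $w$ is \emph{straightenable} if $I^{\widetilde g}=\tau^w\,\pi^*I^g$ for every Einstein $n$-manifold $(M,g)$ and every such $\varepsilon$. \textbf{Proposition.} Let $n\ge3$, $k\in\mathbb R$, and $\ell\in\mathbb N=\{0,1,2,\dots\}$. There are constants $a_1,\dots,a_\ell\in\mathbb R$, depending only on $n,k,\ell$, such that the following holds for every straightenable scalar Riemannian invariant $I$ of weight $-2k$. Set \[ I_\ell:=\Bigl(\prod_{j=0}^{\ell-1}\Bigl(\Delta-\frac{4(k+j)(n-2k-2j-1)}{n}J\Bigr)\Bigr)I , \] the factors being composed in any order. Then $I_\ell$ is (expressible as) a scalar Riemannian invariant, and it is straightenable of weight $-2k-2\ell$. Moreover, if $(M,g)$ is an Einstein $n$-manifold with $\mathrm{Ric}_g=2\lambda(n-1)g$, then \[ I_\ell=\Bigl(-\frac4nJ\Bigr)^{\ell}\prod_{j=0}^{\ell-1}(k+j)(n-2k-2j-1)\;I+\sum_{i=1}^{\ell}a_i\lambda^{\ell-i}\Delta^iI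 ; \] in particular $I_\ell$ is congruent to the first term modulo the real span of $\Delta I,\dots,\Delta^\ell I$. If $k$ is a positive integer and $2k+2\ell\le n$, then this reads, with the same $a_i$, \[ I_\ell=\Bigl(-\frac4nJ\Bigr)^{\ell}\frac{(k+\ell-1)!\,(n-2k-1)!!}{(k-1)!\,(n-2k-2\ell-1)!!}\,I+\sum_{i=1}^{\ell}a_i\lambda^{\ell-i}\Delta^iI , \] where $(-1)!!:=1$. -/

import Mathlib

open scoped Manifold ContDiff
open Bundle

universe u

noncomputable section

/-! ### Tensor calculus of a pseudo-Riemannian metric in local coordinates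

`E` is the coordinate space, `b` a basis of `E` (whose members are the coordinate directions), and
`h y i j` are the components of the metric at the coordinate point `y`. A covariant tensor field
of rank `k` is given by its components `T y a`, where `a : Fin k → ι` lists the `k` indices. -/

section LocalCalculus

variable {ι : Type} [Fintype ι] [DecidableEq ι]
  {E : Type} [NormedAddCommGroup E] [NormedSpace ℝ E]

/-- The partial derivative `∂_i f`. -/
def partialDeriv (b : Module.Basis ι ℝ E) (i : ι) (f : E → ℝ) (y : E) : ℝ :=
  fderiv ℝ f y (b i)

/-- The Christoffel symbol `Γ^c_{ij}` of the Levi-Civita connection of `h`. -/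
def christoffel (b : Module.Basis ι ℝ E) (h : E → Matrix ι ι ℝ) (c i j : ι) (y : E) : ℝ :=
  (1 / 2) * ∑ l, (h y)⁻¹ c l *
    (partialDeriv b i (fun z => h z j l) y + partialDeriv b j (fun z => h z i l) y
      - partialDeriv b l (fun z => h z i j) y)

/-- The covariant derivative `∇_{a₀} T_{a₁ ⋯ aₖ}` of a covariant tensor field; the index of the
derivative comes first. -/
def covDeriv (b : Module.Basis ι ℝ E) (h : E → Matrix ι ι ℝ) {k : ℕ}
    (T : E → (Fin k → ι) → ℝ) : E → (Fin (k + 1) → ι) → ℝ :=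
  fun y a =>
    partialDeriv b (a 0) (fun z => T z (Fin.tail a)) y
      - ∑ s : Fin k, ∑ m : ι,
          christoffel b h m (a 0) (Fin.tail a s) y * T y (Function.update (Fin.tail a) s m)

/-- The curvature `R_{ijc}{}^d`, with the convention `∇_i ∇_j τ_c - ∇_j ∇_i τ_c = R_{ijc}{}^d τ_d`. -/
def curvature (b : Module.Basis ι ℝ E) (h : E → Matrix ι ι ℝ) (i j c d : ι) (y : E) : ℝ :=
  partialDeriv b j (christoffel b h d i c) y - partialDeriv b i (christoffel b h d j c) y
    + ∑ e, (christoffel b h e i c y * christoffel b h d j e y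
        - christoffel b h e j c y * christoffel b h d i e y)

/-- The Riemann curvature tensor `R_{ijcd} = R_{ijc}{}^e h_{ed}` as a covariant tensor field. -/
def riemann (b : Module.Basis ι ℝ E) (h : E → Matrix ι ι ℝ) : E → (Fin 4 → ι) → ℝ :=
  fun y a => ∑ e, curvature b h (a 0) (a 1) (a 2) e y * h y e (a 3)

/-- The `N`-th covariant derivative `∇^N Rm`. -/
def iterCovDerivRiemann (b : Module.Basis ι ℝ E) (h : E → Matrix ι ι ℝ) :
    (N : ℕ) → E → (Fin (4 + N) → ι) → ℝ
  | 0 => riemann b h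
  | N + 1 => covDeriv b h (iterCovDerivRiemann b h N)

/-- The Ricci tensor `R_{ij} = R_{icj}{}^c`. -/
def ricci (b : Module.Basis ι ℝ E) (h : E → Matrix ι ι ℝ) (i j : ι) (y : E) : ℝ :=
  ∑ c, curvature b h i c j c y

/-- The scalar curvature. -/
def scalarCurvature (b : Module.Basis ι ℝ E) (h : E → Matrix ι ι ℝ) (y : E) : ℝ :=
  ∑ i, ∑ j, (h y)⁻¹ i j * ricci b h i j y

/-- The scalar invariant `J = R / (2 (n - 1))`. In dimension `n` it is the trace of the Schouten
tensor `P_{ij} = (R_{ij} - J h_{ij}) / (n - 2)`. The number `n` is a fixed coefficient: it does not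
change when the invariant is evaluated at a metric in another dimension. -/
def schoutenJ (n : ℕ) (b : Module.Basis ι ℝ E) (h : E → Matrix ι ι ℝ) (y : E) : ℝ :=
  scalarCurvature b h y / (2 * ((n : ℝ) - 1))

/-- The Laplace–Beltrami operator `Δ u = h^{ij} ∇_i ∇_j u` on functions. -/
def laplacian (b : Module.Basis ι ℝ E) (h : E → Matrix ι ι ℝ) (u : E → ℝ) (y : E) : ℝ :=
  ∑ i, ∑ j, (h y)⁻¹ i j *
    (partialDeriv b i (partialDeriv b j u) y - ∑ c, christoffel b h c i j y * partialDeriv b c u y)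

/-- `h` is (the component matrix of) a smooth pseudo-Riemannian metric on the open set `U`. -/
structure IsLocalMetric (U : Set E) (h : E → Matrix ι ι ℝ) : Prop where
  isOpen : IsOpen U
  smooth : ∀ i j, ContDiffOn ℝ ∞ (fun y => h y i j) U
  symm : ∀ y ∈ U, ∀ i j, h y i j = h y j i
  nondegenerate : ∀ y ∈ U, (h y).det ≠ 0

end LocalCalculus

/-! ### Riemannian invariants -/

/-- Expressions for tensor Riemannian invariants of rank `k`: linear combinations, with fixed real
coefficients, of partial contractions of tensor products of covariant derivatives `∇^N Rm` of the
Riemann curvature tensor and copies of the metric; the empty product is the constant `1`. -/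
inductive TensorInvariant : ℕ → Type
  | nablaRm (N : ℕ) : TensorInvariant (4 + N)
  | metric : TensorInvariant 2
  | one : TensorInvariant 0
  | tensor {j k : ℕ} (A : TensorInvariant j) (B : TensorInvariant k) : TensorInvariant (j + k)
  | reindex {j k : ℕ} (σ : Fin j ≃ Fin k) (A : TensorInvariant j) : TensorInvariant k
  | contract {k : ℕ} (A : TensorInvariant (k + 2)) : TensorInvariant k
  | add {k : ℕ} (A B : TensorInvariant k) : TensorInvariant k
  | smul {k : ℕ} (c : ℝ) (A : TensorInvariant k) : TensorInvariant k

/-- Evaluation at a metric in local coordinates, in any dimension. Contractions use the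
inverse metric and contract the first two indices; `reindex` permutes the indices. -/
def TensorInvariant.eval {ι : Type} [Fintype ι] [DecidableEq ι]
    {E : Type} [NormedAddCommGroup E] [NormedSpace ℝ E]
    (b : Module.Basis ι ℝ E) (h : E → Matrix ι ι ℝ) :
    {k : ℕ} → TensorInvariant k → E → (Fin k → ι) → ℝ
  | _, .nablaRm N => iterCovDerivRiemann b h N
  | _, .metric => fun y a => h y (a 0) (a 1)
  | _, .one => fun _ _ => 1
  | _, .tensor (j := j) (k := k) A B => fun y a =>
      A.eval b h y (fun s => a (Fin.castAdd k s)) * B.eval b h y (fun s => a (Fin.natAdd j s))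
  | _, .reindex σ A => fun y a => A.eval b h y (fun s => a (σ s))
  | _, .contract A => fun y a =>
      ∑ i, ∑ j, (h y)⁻¹ i j * A.eval b h y (Fin.cons i (Fin.cons j a))
  | _, .add A B => fun y a => A.eval b h y a + B.eval b h y a
  | _, .smul c A => fun y a => c * A.eval b h y a

/-- Scalar Riemannian invariants are tensor Riemannian invariants of rank `0`. -/
abbrev ScalarInvariant : Type := TensorInvariant 0

/-- The scalar function that a scalar Riemannian invariant assigns to a metric. -/
def ScalarInvariant.toFun {ι : Type} [Fintype ι] [DecidableEq ι]
    {E : Type} [NormedAddCommGroup E] [NormedSpace ℝ E]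
    (A : ScalarInvariant) (b : Module.Basis ι ℝ E) (h : E → Matrix ι ι ℝ) : E → ℝ :=
  fun y => TensorInvariant.eval b h A y Fin.elim0

/-! ### Pseudo-Riemannian manifolds -/

section Manifolds

/-- A smooth pseudo-Riemannian metric, of arbitrary signature, on an `n`-manifold. -/
structure PseudoRiemannianMetric (n : ℕ) (M : Type u) [TopologicalSpace M]
    [ChartedSpace (EuclideanSpace ℝ (Fin n)) M] [IsManifold (𝓡 n) ∞ M] where
  inner (x : M) : TangentSpace (𝓡 n) x →L[ℝ] TangentSpace (𝓡 n) x →L[ℝ] ℝ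
  symm (x : M) (v w : TangentSpace (𝓡 n) x) : inner x v w = inner x w v
  nondegenerate (x : M) (v : TangentSpace (𝓡 n) x) (hv : ∀ w, inner x v w = 0) : v = 0
  contMDiff : ContMDiff (𝓡 n)
    ((𝓡 n).prod 𝓘(ℝ, EuclideanSpace ℝ (Fin n) →L[ℝ] EuclideanSpace ℝ (Fin n) →L[ℝ] ℝ)) ∞
    (fun x => TotalSpace.mk' (EuclideanSpace ℝ (Fin n) →L[ℝ] EuclideanSpace ℝ (Fin n) →L[ℝ] ℝ)
      x (inner x))

/-- The components `g(∂_i, ∂_j)` of a field `g` of bilinear forms on the tangent spaces, in the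
local coordinates given by the chart `e`. -/
def chartComponents {ι : Type} {E H : Type} [NormedAddCommGroup E] [NormedSpace ℝ E]
    [TopologicalSpace H] (I : ModelWithCorners ℝ E H) (b : Module.Basis ι ℝ E)
    {M : Type u} [TopologicalSpace M] [ChartedSpace H M]
    (g : ∀ x : M, TangentSpace I x → TangentSpace I x → ℝ)
    (e : OpenPartialHomeomorph M H) (y : E) : Matrix ι ι ℝ :=
  Matrix.of fun i j =>
    g ((e.extend I).symm y)
      (mfderiv 𝓘(ℝ, E) I (e.extend I).symm y (b i))
      (mfderiv 𝓘(ℝ, E) I (e.extend I).symm y (b j))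

/-- The standard basis of `ℝⁿ`. -/
abbrev stdBasis (n : ℕ) : Module.Basis (Fin n) ℝ (EuclideanSpace ℝ (Fin n)) :=
  (EuclideanSpace.basisFun (Fin n) ℝ).toBasis

section Fields

variable {n : ℕ} {M : Type u} [TopologicalSpace M]
  [ChartedSpace (EuclideanSpace ℝ (Fin n)) M] [IsManifold (𝓡 n) ∞ M]

/-- The components of the metric `g` in the chart `e`. -/
def PseudoRiemannianMetric.components (g : PseudoRiemannianMetric n M)
    (e : OpenPartialHomeomorph M (EuclideanSpace ℝ (Fin n))) :
    EuclideanSpace ℝ (Fin n) → Matrix (Fin n) (Fin n) ℝ :=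
  chartComponents (𝓡 n) (stdBasis n) (fun x v w => g.inner x v w) e

/-- The components of the rescaled metric `c² g` in the chart `e`. -/
def PseudoRiemannianMetric.scaledComponents (c : ℝ) (g : PseudoRiemannianMetric n M)
    (e : OpenPartialHomeomorph M (EuclideanSpace ℝ (Fin n))) :
    EuclideanSpace ℝ (Fin n) → Matrix (Fin n) (Fin n) ℝ :=
  chartComponents (𝓡 n) (stdBasis n) (fun x v w => c ^ 2 * g.inner x v w) e

/-- `g` is an Einstein metric with `Ric = 2 λ (n - 1) g`. -/
def PseudoRiemannianMetric.IsEinstein (g : PseudoRiemannianMetric n M) (lam : ℝ) : Prop :=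
  ∀ e ∈ IsManifold.maximalAtlas (𝓡 n) ∞ M, ∀ x ∈ e.source, ∀ i j,
    ricci (stdBasis n) (g.components e) i j (e x) =
      2 * lam * ((n : ℝ) - 1) * g.components e (e x) i j

/-! ### The ambient space

The ambient space `(0, ∞) × M × (-ε, ε)` is an open subset of the manifold `ℝ × M × ℝ`; its points
are written `p = (t, x, ρ)`. -/

/-- The open subset `(0, ∞) × M × (-ε, ε)` of `ℝ × M × ℝ`. -/
def ambientSpace (M : Type u) (ε : ℝ) : Set (ℝ × M × ℝ) :=
  {p | 0 < p.1 ∧ p.2.2 ∈ Set.Ioo (-ε) ε}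

/-- The function `τ = t (1 + λ ρ)`. -/
def ambientTau (lam : ℝ) (p : ℝ × M × ℝ) : ℝ :=
  p.1 * (1 + lam * p.2.2)

/-- The model with corners of `ℝ × M × ℝ`. -/
abbrev ambientModel (n : ℕ) : ModelWithCorners ℝ (ℝ × EuclideanSpace ℝ (Fin n) × ℝ)
    (ModelProd ℝ (ModelProd (EuclideanSpace ℝ (Fin n)) ℝ)) :=
  𝓘(ℝ, ℝ).prod ((𝓡 n).prod 𝓘(ℝ, ℝ))

/-- The metric `2 ρ dt² + 2 t dt dρ + τ² g`. -/
def PseudoRiemannianMetric.ambient (g : PseudoRiemannianMetric n M) (lam : ℝ) (p : ℝ × M × ℝ)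
    (v w : TangentSpace (ambientModel n) p) : ℝ :=
  2 * p.2.2 * (v.1 * w.1) + p.1 * (v.1 * w.2.2 + v.2.2 * w.1)
    + ambientTau lam p ^ 2 * g.inner p.2.1 v.2.1 w.2.1

/-- The product chart `(t, e, ρ)` of `ℝ × M × ℝ`. -/
def ambientChart (e : OpenPartialHomeomorph M (EuclideanSpace ℝ (Fin n))) :
    OpenPartialHomeomorph (ℝ × M × ℝ) (ModelProd ℝ (ModelProd (EuclideanSpace ℝ (Fin n)) ℝ)) :=
  (OpenPartialHomeomorph.refl ℝ).prod (e.prod (OpenPartialHomeomorph.refl ℝ))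

/-- The basis `∂_t, ∂_1, …, ∂_n, ∂_ρ` of the coordinate space of `ℝ × M × ℝ`. -/
abbrev ambientBasis (n : ℕ) :
    Module.Basis (Unit ⊕ (Fin n ⊕ Unit)) ℝ (ℝ × EuclideanSpace ℝ (Fin n) × ℝ) :=
  (Module.Basis.singleton Unit ℝ).prod ((stdBasis n).prod (Module.Basis.singleton Unit ℝ))

/-- The components of the ambient metric in the product chart of `e`. -/
def PseudoRiemannianMetric.ambientComponents (g : PseudoRiemannianMetric n M) (lam : ℝ)
    (e : OpenPartialHomeomorph M (EuclideanSpace ℝ (Fin n))) :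
    ℝ × EuclideanSpace ℝ (Fin n) × ℝ →
      Matrix (Unit ⊕ (Fin n ⊕ Unit)) (Unit ⊕ (Fin n ⊕ Unit)) ℝ :=
  chartComponents (ambientModel n) (ambientBasis n) (g.ambient lam) (ambientChart e)

end Fields

/-- On `n`-manifolds, `A` has weight `w`: its value at `c² g` is `c ^ w` times its value at `g`. -/
def ScalarInvariant.HasWeight (n : ℕ) (A : ScalarInvariant) (w : ℝ) : Prop :=
  ∀ (M : Type u) [TopologicalSpace M] [T2Space M] [SecondCountableTopology M]
    [ChartedSpace (EuclideanSpace ℝ (Fin n)) M] [IsManifold (𝓡 n) ∞ M]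
    (g : PseudoRiemannianMetric n M) (c : ℝ), 0 < c →
    ∀ e ∈ IsManifold.maximalAtlas (𝓡 n) ∞ M, ∀ x ∈ e.source,
      A.toFun (stdBasis n) (g.scaledComponents c e) (e x) =
        c ^ w * A.toFun (stdBasis n) (g.components e) (e x)

/-- `A` is a straightenable scalar Riemannian invariant of weight `w` on `n`-manifolds: it has
weight `w` and, for every Einstein `n`-manifold `(M, g)` with `Ric = 2 λ (n - 1) g`, the evaluation
of `A` at the ambient space `(0, ∞) × M × (-ε, ε)` is `τ ^ w` times the pullback of its evaluation
at `(M, g)`. Here `ε` is any number such that `1 + λ ρ` does not vanish for `|ρ| < ε`, i.e. such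
that the ambient metric is nondegenerate. Both evaluations are computed in local coordinates, for
every chart `e` of `M` and the product chart of `e`. -/
structure ScalarInvariant.IsStraightenable (n : ℕ) (A : ScalarInvariant) (w : ℝ) : Prop where
  hasWeight : ScalarInvariant.HasWeight.{u} n A w
  straight : ∀ (M : Type u) [TopologicalSpace M] [T2Space M] [SecondCountableTopology M]
    [ChartedSpace (EuclideanSpace ℝ (Fin n)) M] [IsManifold (𝓡 n) ∞ M]
    (g : PseudoRiemannianMetric n M) (lam : ℝ), g.IsEinstein lam →
    ∀ ε : ℝ, 0 < ε → |lam| * ε ≤ 1 →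
    ∀ e ∈ IsManifold.maximalAtlas (𝓡 n) ∞ M, ∀ p ∈ ambientSpace M ε, p.2.1 ∈ e.source →
      A.toFun (ambientBasis n) (g.ambientComponents lam e) (p.1, e p.2.1, p.2.2) =
        ambientTau lam p ^ w * A.toFun (stdBasis n) (g.components e) (e p.2.1)

/-- The operator `Δ - (4 (k + j) (n - 2k - 2j - 1) / n) J` on functions. -/
def straightFactor {ι : Type} [Fintype ι] [DecidableEq ι]
    {E : Type} [NormedAddCommGroup E] [NormedSpace ℝ E]
    (n : ℕ) (k : ℝ) (b : Module.Basis ι ℝ E) (h : E → Matrix ι ι ℝ) (j : ℕ)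
    (v : E → ℝ) : E → ℝ :=
  fun y => laplacian b h v y
    - 4 * (k + j) * ((n : ℝ) - 2 * k - 2 * j - 1) / n * schoutenJ n b h y * v y

/-- `B` is the scalar Riemannian invariant obtained from `A` by applying the operators
`Δ - (4 (k + j) (n - 2k - 2j - 1) / n) J`, with `j` running through the list `L`: this holds at every
metric in local coordinates in every dimension, with the same coefficients. -/
def ScalarInvariant.IsStraightProduct (n : ℕ) (k : ℝ) (L : List ℕ) (A B : ScalarInvariant) :
    Prop :=
  ∀ (ι : Type) [Fintype ι] [DecidableEq ι] (E : Type) [NormedAddCommGroup E] [NormedSpace ℝ E]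
    (b : Module.Basis ι ℝ E) (U : Set E) (h : E → Matrix ι ι ℝ), IsLocalMetric U h →
    ∀ y ∈ U, B.toFun b h y = L.foldr (straightFactor n k b h) (A.toFun b h) y

/-- At every Einstein `n`-manifold `(M, g)` with `Ric = 2 λ (n - 1) g`,
`B = (-4 J / n) ^ ℓ * C * A + ∑_{i = 1}^ℓ a_i λ^{ℓ - i} Δ^i A`. -/
def ScalarInvariant.EinsteinCongruence (n ℓ : ℕ) (a : ℕ → ℝ) (C : ℝ) (A B : ScalarInvariant) :
    Prop :=
  ∀ (M : Type u) [TopologicalSpace M] [T2Space M] [SecondCountableTopology M]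
    [ChartedSpace (EuclideanSpace ℝ (Fin n)) M] [IsManifold (𝓡 n) ∞ M]
    (g : PseudoRiemannianMetric n M) (lam : ℝ), g.IsEinstein lam →
    ∀ e ∈ IsManifold.maximalAtlas (𝓡 n) ∞ M, ∀ x ∈ e.source,
      B.toFun (stdBasis n) (g.components e) (e x) =
        (-(4 / (n : ℝ)) * schoutenJ n (stdBasis n) (g.components e) (e x)) ^ ℓ * C *
            A.toFun (stdBasis n) (g.components e) (e x)
          + ∑ i ∈ Finset.Icc 1 ℓ, a i * lam ^ (ℓ - i) *
              (laplacian (stdBasis n) (g.components e))^[i]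
                (A.toFun (stdBasis n) (g.components e)) (e x)

end Manifolds

end

/-! The mechanism is a single computation on the cone metric `g̃ = 2ρ dt² + 2t dt dρ + τ² g`, `τ =
t(1 + λρ)`. For a function `u` on the base, `Δ̃(τ^w u) = τ^(w-2) (Δu + 2λ w (w - 1 + n) u)`
(`laplacian_coneMetric`). For `w = -2k - 2j` the zeroth-order coefficient is `-4λ(k + j)(n - 2k - 2j
- 1)`. An Einstein base has `J = nλ`, so the bracket is exactly the `j`-th factor applied to `u`.
When `g` is Einstein the scalar curvature of `g̃` vanishes (`scalarCurvature_coneMetric`), so on the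
cone every factor is just `Δ̃`. Hence the `j`-th factor takes `τ^(-2k-2j) u` on the cone to
`τ^(-2k-2j-2)` times its own value on the base, and straightenability follows by induction on the
number of factors, with `j = 0` innermost. Any other order gives the same result, because `J` is
constant on the Einstein base and on its cone, where the factors are therefore polynomials in the
Laplacian and commute.

That the product is again a Riemannian invariant is a structural induction: covariant
differentiation preserves tensor invariants (`TensorInvariant.exists_isCovDeriv`), by the Leibniz
rule and `∇g = 0`; the Laplacian is a contraction of the second derivative, and `J` is a multiple of
a contraction of the curvature. The weight follows since `Δ` and `J` both scale by `c⁻²` under `g ↦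
c²g`.

The expansion over an Einstein metric is algebra: `∏ (X - λ c_j)` is the fixed polynomial `∏ (X -
c_j)` with its roots scaled by `λ`, so its `i`-th coefficient is `a_i λ^(ℓ-i)` with `a_i` depending
only on `n, k, ℓ`. The constant term, with `λ = J/n`, is the leading term. -/

noncomputable section

set_option linter.unusedSimpArgs false

/-! ### Smoothness, locality and metric compatibility in coordinates. -/

section LocalCalculusLemmas

variable {ι : Type} {E : Type} [NormedAddCommGroup E] [NormedSpace ℝ E]
  {b : Module.Basis ι ℝ E} {h : E → Matrix ι ι ℝ} {U : Set E} {y : E}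

theorem differentiableAt_of_contDiffOn {f : E → ℝ} (hf : ContDiffOn ℝ ∞ f U) (hU : IsOpen U)
    (hy : y ∈ U) : DifferentiableAt ℝ f y :=
  (hf.contDiffAt (hU.mem_nhds hy)).differentiableAt (by simp)

theorem partialDeriv_congr {f g : E → ℝ} (hU : IsOpen U) (hfg : Set.EqOn f g U) (hy : y ∈ U)
    (i : ι) : partialDeriv b i f y = partialDeriv b i g y := by
  have : f =ᶠ[nhds y] g := Filter.mem_of_superset (hU.mem_nhds hy) hfg
  simp only [partialDeriv, this.fderiv_eq]

theorem contDiffOn_partialDeriv {f : E → ℝ} (hU : IsOpen U) (hf : ContDiffOn ℝ ∞ f U) (i : ι) :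
    ContDiffOn ℝ ∞ (partialDeriv b i f) U :=
  (hf.fderiv_of_isOpen hU (by simp)).clm_apply contDiffOn_const

theorem partialDeriv_const (c : ℝ) (i : ι) : partialDeriv b i (fun _ => c) y = 0 := by
  simp [partialDeriv]

theorem partialDeriv_add {f g : E → ℝ} (hf : DifferentiableAt ℝ f y) (hg : DifferentiableAt ℝ g y)
    (i : ι) : partialDeriv b i (fun z => f z + g z) y
      = partialDeriv b i f y + partialDeriv b i g y := by
  simp only [partialDeriv, fderiv_fun_add hf hg, add_apply]

theorem partialDeriv_mul {f g : E → ℝ} (hf : DifferentiableAt ℝ f y) (hg : DifferentiableAt ℝ g y)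
    (i : ι) : partialDeriv b i (fun z => f z * g z) y
      = partialDeriv b i f y * g y + f y * partialDeriv b i g y := by
  simp only [partialDeriv, fderiv_fun_mul hf hg, add_apply,
    smul_apply, smul_eq_mul]
  ring

theorem partialDeriv_const_mul (c : ℝ) (f : E → ℝ) (i : ι) :
    partialDeriv b i (fun z => c * f z) y = c * partialDeriv b i f y := by
  have : (fun z => c * f z) = c • f := rfl
  simp only [partialDeriv, this, fderiv_const_smul_field]
  rfl

theorem partialDeriv_sum {α : Type*} (s : Finset α) {f : α → E → ℝ}
    (hf : ∀ x ∈ s, DifferentiableAt ℝ (f x) y) (i : ι) :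
    partialDeriv b i (fun z => ∑ x ∈ s, f x z) y = ∑ x ∈ s, partialDeriv b i (f x) y := by
  simp only [partialDeriv, fderiv_fun_sum hf, sum_apply]

theorem contDiffOn_det {κ : Type} [Fintype κ] [DecidableEq κ] {A : E → Matrix κ κ ℝ}
    (hA : ∀ i j, ContDiffOn ℝ ∞ (fun y => A y i j) U) : ContDiffOn ℝ ∞ (fun y => (A y).det) U := by
  simp only [Matrix.det_apply']
  exact ContDiffOn.sum fun σ _ => contDiffOn_const.mul (contDiffOn_prod fun i _ => hA _ _)

variable [Fintype ι] [DecidableEq ι]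

namespace IsLocalMetric

theorem isUnit_det (hh : IsLocalMetric U h) (hy : y ∈ U) : IsUnit (h y).det :=
  (hh.nondegenerate y hy).isUnit

/-- Cramer's rule: the entries are determinants divided by a nowhere vanishing determinant. -/
theorem smooth_inv (hh : IsLocalMetric U h) (i j : ι) :
    ContDiffOn ℝ ∞ (fun y => (h y)⁻¹ i j) U := by
  simp only [Matrix.inv_def, Matrix.smul_apply, Ring.inverse_eq_inv', smul_eq_mul,
    Matrix.adjugate_apply]
  refine ((contDiffOn_det hh.smooth).inv hh.nondegenerate).mul (contDiffOn_det fun p q => ?_)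
  by_cases hp : p = j
  · subst hp; simpa using contDiffOn_const
  · simpa [Matrix.updateRow_ne hp] using hh.smooth p q

theorem inv_symm (hh : IsLocalMetric U h) (hy : y ∈ U) (i j : ι) :
    (h y)⁻¹ i j = (h y)⁻¹ j i := by
  have : (h y).transpose = h y := Matrix.ext fun i j => hh.symm y hy j i
  calc (h y)⁻¹ i j = (h y)⁻¹.transpose j i := rfl
    _ = _ := by rw [Matrix.transpose_nonsing_inv, this]

theorem sum_inv_mul (hh : IsLocalMetric U h) (hy : y ∈ U) (i j : ι) :
    ∑ l, (h y)⁻¹ i l * h y l j = if i = j then 1 else 0 := by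
  rw [← Matrix.mul_apply, Matrix.nonsing_inv_mul _ (hh.isUnit_det hy), Matrix.one_apply]

theorem sum_mul_inv (hh : IsLocalMetric U h) (hy : y ∈ U) (i j : ι) :
    ∑ l, h y i l * (h y)⁻¹ l j = if i = j then 1 else 0 := by
  rw [← Matrix.mul_apply, Matrix.mul_nonsing_inv _ (hh.isUnit_det hy), Matrix.one_apply]

theorem smooth_christoffel (hh : IsLocalMetric U h) (c i j : ι) :
    ContDiffOn ℝ ∞ (christoffel b h c i j) U := by
  unfold christoffel
  refine contDiffOn_const.mul (ContDiffOn.sum fun l _ => (hh.smooth_inv c l).mul ?_)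
  exact ((contDiffOn_partialDeriv hh.isOpen (hh.smooth _ _) _).add
    (contDiffOn_partialDeriv hh.isOpen (hh.smooth _ _) _)).sub
    (contDiffOn_partialDeriv hh.isOpen (hh.smooth _ _) _)

theorem partialDeriv_symm (hh : IsLocalMetric U h) (hy : y ∈ U) (p i j : ι) :
    partialDeriv b p (fun z => h z i j) y = partialDeriv b p (fun z => h z j i) y :=
  partialDeriv_congr hh.isOpen (fun z hz => hh.symm z hz i j) hy p

/-- Lowering the upper index cancels the inverse metric and leaves the Christoffel symbol of the
first kind. Adding two of these gives metric compatibility. -/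
theorem sum_christoffel_mul (hh : IsLocalMetric U h) (hy : y ∈ U) (p i j : ι) :
    ∑ m, christoffel b h m p i y * h y m j
      = (1 / 2) * (partialDeriv b p (fun z => h z i j) y + partialDeriv b i (fun z => h z p j) y
          - partialDeriv b j (fun z => h z p i) y) := by
  set D : ι → ℝ := fun l => partialDeriv b p (fun z => h z i l) y
    + partialDeriv b i (fun z => h z p l) y - partialDeriv b l (fun z => h z p i) y
  have h1 : ∀ m, christoffel b h m p i y * h y m j
      = ∑ l, (1 / 2) * D l * ((h y)⁻¹ l m * h y m j) := fun m => by
    simp only [christoffel, Finset.mul_sum, Finset.sum_mul]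
    refine Finset.sum_congr rfl fun l _ => ?_
    rw [hh.inv_symm hy m l]; simp only [D]; ring
  simp only [h1]
  rw [Finset.sum_comm]
  simp only [← Finset.mul_sum, hh.sum_inv_mul hy, mul_ite, mul_one, mul_zero,
    Finset.sum_ite_eq', Finset.mem_univ, if_true, D]

/-- The Levi-Civita connection preserves the metric. -/
theorem partialDeriv_metric (hh : IsLocalMetric U h) (hy : y ∈ U) (p i j : ι) :
    partialDeriv b p (fun z => h z i j) y
      = ∑ m, christoffel b h m p i y * h y m j + ∑ m, christoffel b h m p j y * h y i m := by
  have h2 : ∑ m, christoffel b h m p j y * h y i m = ∑ m, christoffel b h m p j y * h y m i :=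
    Finset.sum_congr rfl fun m _ => by rw [hh.symm y hy i m]
  rw [h2, hh.sum_christoffel_mul hy, hh.sum_christoffel_mul hy, hh.partialDeriv_symm hy p j i]
  ring

/-- Differentiating `h⁻¹h = 1` gives `∂h⁻¹ = -h⁻¹(∂h)h⁻¹`; metric compatibility then replaces `∂h`
by `Γᵀh + hΓ`. This is `∇h⁻¹ = 0`, needed to commute `∇` with contractions. -/
theorem partialDeriv_inv (hh : IsLocalMetric U h) (hy : y ∈ U) (p i j : ι) :
    partialDeriv b p (fun z => (h z)⁻¹ i j) y
      = -∑ m, christoffel b h i p m y * (h y)⁻¹ m j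
        - ∑ m, christoffel b h j p m y * (h y)⁻¹ i m := by
  set D : Matrix ι ι ℝ := Matrix.of fun i j => partialDeriv b p (fun z => (h z)⁻¹ i j) y
  set M : Matrix ι ι ℝ := Matrix.of fun i j => partialDeriv b p (fun z => h z i j) y
  set G : Matrix ι ι ℝ := Matrix.of fun m i => christoffel b h m p i y
  have hM : M = G.transpose * h y + h y * G := by
    ext i j
    simp only [M, Matrix.of_apply, Matrix.add_apply, Matrix.mul_apply, Matrix.transpose_apply, G,
      hh.partialDeriv_metric hy]
    congr 1
    exact Finset.sum_congr rfl fun _ _ => mul_comm _ _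
  have hD : D * h y + (h y)⁻¹ * M = 0 := by
    ext i j
    have h1 : partialDeriv b p (fun z => ∑ l, (h z)⁻¹ i l * h z l j) y = 0 := by
      rw [partialDeriv_congr hh.isOpen (fun z hz => hh.sum_inv_mul hz i j) hy]
      exact partialDeriv_const _ _
    have hd : ∀ l, DifferentiableAt ℝ (fun z => (h z)⁻¹ i l) y := fun l =>
      differentiableAt_of_contDiffOn (hh.smooth_inv i l) hh.isOpen hy
    have hd' : ∀ l, DifferentiableAt ℝ (fun z => h z l j) y := fun l =>
      differentiableAt_of_contDiffOn (hh.smooth l j) hh.isOpen hy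
    rw [partialDeriv_sum _ fun l _ => (hd l).fun_mul (hd' l)] at h1
    simp only [partialDeriv_mul (hd _) (hd' _), Finset.sum_add_distrib] at h1
    simpa [Matrix.mul_apply, D, M] using h1
  have hu := hh.isUnit_det hy
  have h3 : D = -((h y)⁻¹ * M * (h y)⁻¹) := by
    have := congrArg (· * (h y)⁻¹) hD
    simp only [add_mul, Matrix.mul_assoc, Matrix.mul_nonsing_inv _ hu, Matrix.mul_one,
      Matrix.zero_mul] at this
    rw [eq_neg_of_add_eq_zero_left this, Matrix.mul_assoc]
  have h4 : D = -(G * (h y)⁻¹) - (h y)⁻¹ * G.transpose := by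
    rw [h3, hM]
    simp only [Matrix.mul_add, Matrix.add_mul, Matrix.mul_assoc, Matrix.mul_nonsing_inv _ hu,
      Matrix.mul_one]
    rw [← Matrix.mul_assoc (h y)⁻¹ (h y), Matrix.nonsing_inv_mul _ hu, Matrix.one_mul]
    abel
  have h5 := congrFun (congrFun h4 i) j
  simp only [D, G, Matrix.of_apply, Matrix.sub_apply, Matrix.neg_apply, Matrix.mul_apply,
    Matrix.transpose_apply] at h5
  rw [h5]
  congr 1
  exact Finset.sum_congr rfl fun _ _ => mul_comm _ _

theorem smooth_covDeriv (hh : IsLocalMetric U h) {k : ℕ} {T : E → (Fin k → ι) → ℝ}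
    (hT : ∀ a, ContDiffOn ℝ ∞ (fun y => T y a) U) (a : Fin (k + 1) → ι) :
    ContDiffOn ℝ ∞ (fun y => covDeriv b h T y a) U := by
  unfold covDeriv
  exact (contDiffOn_partialDeriv hh.isOpen (hT _) _).sub (ContDiffOn.sum fun s _ =>
    ContDiffOn.sum fun m _ => (hh.smooth_christoffel _ _ _).mul (hT _))

theorem smooth_curvature (hh : IsLocalMetric U h) (i j c d : ι) :
    ContDiffOn ℝ ∞ (curvature b h i j c d) U := by
  unfold curvature
  have hc := hh.smooth_christoffel (b := b)
  exact ((contDiffOn_partialDeriv hh.isOpen (hc _ _ _) _).sub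
    (contDiffOn_partialDeriv hh.isOpen (hc _ _ _) _)).add (ContDiffOn.sum fun e _ =>
    ((hc _ _ _).mul (hc _ _ _)).sub ((hc _ _ _).mul (hc _ _ _)))

theorem smooth_iterCovDerivRiemann (hh : IsLocalMetric U h) (N : ℕ) :
    ∀ a, ContDiffOn ℝ ∞ (fun y => iterCovDerivRiemann b h N y a) U := by
  induction N with
  | zero =>
    intro a
    exact ContDiffOn.sum fun e _ => (hh.smooth_curvature _ _ _ _).mul (hh.smooth _ _)
  | succ N ih => exact hh.smooth_covDeriv ih

theorem smooth_eval (hh : IsLocalMetric U h) {k : ℕ} (A : TensorInvariant k) :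
    ∀ a, ContDiffOn ℝ ∞ (fun y => A.eval b h y a) U := by
  induction A with
  | nablaRm N => exact hh.smooth_iterCovDerivRiemann N
  | metric => exact fun a => hh.smooth _ _
  | one => exact fun a => contDiffOn_const
  | tensor A B hA hB => exact fun a => (hA _).mul (hB _)
  | reindex σ A hA => exact fun a => hA _
  | contract A hA =>
    exact fun a => ContDiffOn.sum fun i _ => ContDiffOn.sum fun j _ =>
      (hh.smooth_inv i j).mul (hA _)
  | add A B hA hB => exact fun a => (hA a).add (hB a)
  | smul c A hA => exact fun a => contDiffOn_const.mul (hA a)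

theorem smooth_laplacian (hh : IsLocalMetric U h) {v : E → ℝ} (hv : ContDiffOn ℝ ∞ v U) :
    ContDiffOn ℝ ∞ (laplacian b h v) U := by
  unfold laplacian
  have hp := fun i => contDiffOn_partialDeriv (b := b) hh.isOpen hv i
  exact ContDiffOn.sum fun i _ => ContDiffOn.sum fun j _ => (hh.smooth_inv i j).mul
    ((contDiffOn_partialDeriv hh.isOpen (hp j) i).sub
      (ContDiffOn.sum fun c _ => (hh.smooth_christoffel _ _ _).mul (hp c)))

theorem smooth_schoutenJ (hh : IsLocalMetric U h) (n : ℕ) :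
    ContDiffOn ℝ ∞ (schoutenJ n b h) U := by
  unfold schoutenJ scalarCurvature ricci
  exact (ContDiffOn.sum fun i _ => ContDiffOn.sum fun j _ => (hh.smooth_inv i j).mul
    (ContDiffOn.sum fun c _ => hh.smooth_curvature _ _ _ _)).div_const _

end IsLocalMetric

theorem laplacian_congr {v w : E → ℝ} (hU : IsOpen U) (hvw : Set.EqOn v w U) :
    Set.EqOn (laplacian b h v) (laplacian b h w) U := by
  intro y hy
  have h1 : ∀ j, Set.EqOn (partialDeriv b j v) (partialDeriv b j w) U := fun j z hz =>
    partialDeriv_congr hU hvw hz j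
  simp only [laplacian, h1 _ hy, partialDeriv_congr hU (h1 _) hy]

theorem straightFactor_congr (n : ℕ) (k : ℝ) (j : ℕ) {v w : E → ℝ} (hU : IsOpen U)
    (hvw : Set.EqOn v w U) :
    Set.EqOn (straightFactor n k b h j v) (straightFactor n k b h j w) U := fun y hy => by
  simp only [straightFactor, laplacian_congr hU hvw hy, hvw hy]

end LocalCalculusLemmas

/-! ### The covariant derivative against products, permutations and contractions. -/

section CovariantDerivative

variable {ι : Type} [Fintype ι] [DecidableEq ι] {E : Type} [NormedAddCommGroup E] [NormedSpace ℝ E]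
  {b : Module.Basis ι ℝ E} {h : E → Matrix ι ι ℝ} {U : Set E} {y : E}

theorem covDeriv_cons {k : ℕ} (T : E → (Fin k → ι) → ℝ) (y : E) (p : ι) (a : Fin k → ι) :
    covDeriv b h T y (Fin.cons p a) = partialDeriv b p (fun z => T z a) y
      - ∑ s : Fin k, ∑ m : ι, christoffel b h m p (a s) y * T y (Function.update a s m) := by
  simp only [covDeriv, Fin.cons_zero, Fin.tail_cons]

theorem IsLocalMetric.covDeriv_metric (hh : IsLocalMetric U h) (hy : y ∈ U) (p : ι)
    (a : Fin 2 → ι) : covDeriv b h (fun y a => h y (a 0) (a 1)) y (Fin.cons p a) = 0 := by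
  rw [covDeriv_cons, hh.partialDeriv_metric hy, Fin.sum_univ_two]
  simp

/-- Each Christoffel term replaces one index, which belongs to exactly one of the two factors, so
the sum over slots splits accordingly. -/
theorem covDeriv_tensor {j k : ℕ} {S : E → (Fin j → ι) → ℝ} {T : E → (Fin k → ι) → ℝ}
    (hS : ∀ a, DifferentiableAt ℝ (fun z => S z a) y)
    (hT : ∀ a, DifferentiableAt ℝ (fun z => T z a) y) (p : ι) (a : Fin (j + k) → ι) :
    covDeriv b h (fun z a => S z (fun s => a (Fin.castAdd k s)) * T z (fun s => a (Fin.natAdd j s)))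
        y (Fin.cons p a)
      = covDeriv b h S y (Fin.cons p fun s => a (Fin.castAdd k s))
          * T y (fun s => a (Fin.natAdd j s))
        + S y (fun s => a (Fin.castAdd k s))
          * covDeriv b h T y (Fin.cons p fun s => a (Fin.natAdd j s)) := by
  have h1 : ∀ (s : Fin j) (m : ι), (fun r => Function.update a (Fin.castAdd k s) m (Fin.castAdd k r))
      = Function.update (fun r => a (Fin.castAdd k r)) s m := fun s m => by
    ext r; simp [Function.update_apply]
  have h2 : ∀ (s : Fin j) (m : ι), (fun r => Function.update a (Fin.castAdd k s) m (Fin.natAdd j r))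
      = fun r => a (Fin.natAdd j r) := fun s m => by
    ext r; rw [Function.update_of_ne]; simp [Fin.ext_iff]; omega
  have h3 : ∀ (s : Fin k) (m : ι), (fun r => Function.update a (Fin.natAdd j s) m (Fin.castAdd k r))
      = fun r => a (Fin.castAdd k r) := fun s m => by
    ext r; rw [Function.update_of_ne]; simp [Fin.ext_iff]; omega
  have h4 : ∀ (s : Fin k) (m : ι), (fun r => Function.update a (Fin.natAdd j s) m (Fin.natAdd j r))
      = Function.update (fun r => a (Fin.natAdd j r)) s m := fun s m => by
    ext r; simp [Function.update_apply]
  simp only [covDeriv_cons, partialDeriv_mul (hS _) (hT _), Fin.sum_univ_add, h1, h2, h3, h4,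
    sub_mul, mul_sub, Finset.sum_mul, Finset.mul_sum]
  simp only [mul_left_comm (S y _) _ _, mul_assoc]
  ring

theorem covDeriv_reindex {j k : ℕ} (σ : Fin j ≃ Fin k) (T : E → (Fin j → ι) → ℝ) (p : ι)
    (a : Fin k → ι) :
    covDeriv b h (fun z a => T z (fun s => a (σ s))) y (Fin.cons p a)
      = covDeriv b h T y (Fin.cons p fun s => a (σ s)) := by
  simp only [covDeriv_cons]
  congr 1
  rw [← Equiv.sum_comp σ]
  refine Finset.sum_congr rfl fun s _ => Finset.sum_congr rfl fun m _ => ?_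
  congr 2
  ext r
  simp [Function.update_apply]

/-- The two contracted slots produce Christoffel terms on the right that are absent on the left; the
derivative of the inverse metric supplies exactly these. -/
theorem IsLocalMetric.covDeriv_contract (hh : IsLocalMetric U h) (hy : y ∈ U) {k : ℕ}
    {T : E → (Fin (k + 2) → ι) → ℝ} (hT : ∀ a, DifferentiableAt ℝ (fun z => T z a) y) (p : ι)
    (a : Fin k → ι) :
    covDeriv b h (fun z a => ∑ i, ∑ j, (h z)⁻¹ i j * T z (Fin.cons i (Fin.cons j a))) y
        (Fin.cons p a)
      = ∑ i, ∑ j, (h y)⁻¹ i j * covDeriv b h T y (Fin.cons p (Fin.cons i (Fin.cons j a))) := by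
  have hI : ∀ i j, DifferentiableAt ℝ (fun z => (h z)⁻¹ i j) y := fun i j =>
    differentiableAt_of_contDiffOn (hh.smooth_inv i j) hh.isOpen hy
  have hd : ∀ i j, DifferentiableAt ℝ (fun z => (h z)⁻¹ i j * T z (Fin.cons i (Fin.cons j a))) y :=
    fun i j => (hI i j).fun_mul (hT _)
  simp only [covDeriv_cons, Fin.sum_univ_succ, Fin.cons_zero, Fin.cons_succ, Fin.update_cons_zero,
    ← Fin.cons_update]
  rw [partialDeriv_sum _ fun i _ => DifferentiableAt.fun_sum fun j _ => hd i j]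
  simp only [partialDeriv_sum _ fun j _ => hd _ j, partialDeriv_mul (hI _ _) (hT _),
    hh.partialDeriv_inv hy]
  set F : ι → ι → ℝ := fun i j => T y (Fin.cons i (Fin.cons j a))
  set G : ι → ι → ℝ := fun m i => christoffel b h m p i y
  -- `e1` and `e2` match the two halves of `∂h⁻¹` with the Christoffel terms of the first and second
  -- contracted slot, by renaming summation indices; `e3` handles the free slots.
  have e1 : ∑ i, ∑ j, (∑ m, G i m * (h y)⁻¹ m j) * F i j
      = ∑ i, ∑ j, (h y)⁻¹ i j * ∑ m, G m i * F m j := by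
    simp only [Finset.sum_mul, Finset.mul_sum]
    rw [Finset.sum_congr rfl fun i _ => Finset.sum_comm, Finset.sum_comm]
    refine Finset.sum_congr rfl fun i _ => ?_
    rw [Finset.sum_comm]
    exact Finset.sum_congr rfl fun j _ => Finset.sum_congr rfl fun m _ => by ring
  have e2 : ∑ i, ∑ j, (∑ m, G j m * (h y)⁻¹ i m) * F i j
      = ∑ i, ∑ j, (h y)⁻¹ i j * ∑ m, G m j * F i m := by
    simp only [Finset.sum_mul, Finset.mul_sum]
    refine Finset.sum_congr rfl fun i _ => ?_
    rw [Finset.sum_comm]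
    exact Finset.sum_congr rfl fun j _ => Finset.sum_congr rfl fun m _ => by ring
  have e3 : ∑ s : Fin k, ∑ m, christoffel b h m p (a s) y
        * ∑ i, ∑ j, (h y)⁻¹ i j * T y (Fin.cons i (Fin.cons j (Function.update a s m)))
      = ∑ i, ∑ j, (h y)⁻¹ i j * ∑ s : Fin k, ∑ m, christoffel b h m p (a s) y
        * T y (Fin.cons i (Fin.cons j (Function.update a s m))) := by
    simp only [Finset.mul_sum]
    simp only [fun s : Fin k => Finset.sum_comm (s := (Finset.univ : Finset ι)) (t := Finset.univ)
      (f := fun m i => ∑ j, christoffel b h m p (a s) y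
        * ((h y)⁻¹ i j * T y (Fin.cons i (Fin.cons j (Function.update a s m)))))]
    rw [Finset.sum_comm]
    refine Finset.sum_congr rfl fun i _ => ?_
    simp only [fun s : Fin k => Finset.sum_comm (s := (Finset.univ : Finset ι)) (t := Finset.univ)
      (f := fun m j => christoffel b h m p (a s) y
        * ((h y)⁻¹ i j * T y (Fin.cons i (Fin.cons j (Function.update a s m)))))]
    rw [Finset.sum_comm]
    exact Finset.sum_congr rfl fun j _ => Finset.sum_congr rfl fun s _ =>
      Finset.sum_congr rfl fun m _ => by ring
  rw [e3]
  simp only [sub_mul, neg_mul, mul_sub, mul_add, Finset.sum_add_distrib, Finset.sum_sub_distrib,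
    Finset.sum_neg_distrib]
  rw [e1, e2]
  simp only [F, G]
  ring

end CovariantDerivative

/-! ### Closure of tensor invariants under covariant differentiation. -/

namespace TensorInvariant

/-- The invariant `B` evaluates to the covariant derivative of `A` at every metric. -/
def IsCovDeriv {k : ℕ} (A : TensorInvariant k) (B : TensorInvariant (k + 1)) : Prop :=
  ∀ (ι : Type) [Fintype ι] [DecidableEq ι] (E : Type) [NormedAddCommGroup E] [NormedSpace ℝ E]
    (b : Module.Basis ι ℝ E) (U : Set E) (h : E → Matrix ι ι ℝ), IsLocalMetric U h →
    ∀ y ∈ U, ∀ p a, B.eval b h y (Fin.cons p a) = covDeriv b h (A.eval b h) y (Fin.cons p a)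

/-- The permutation of indices that moves the derivative index of the second factor of a tensor
product to the front. -/
def shiftSecond (j k : ℕ) : Fin (j + (k + 1)) ≃ Fin (j + k + 1) :=
  Equiv.ofBijective
    (Fin.addCases (fun s => (Fin.castAdd k s).succ) (Fin.cases 0 fun s => (Fin.natAdd j s).succ))
    ((Fintype.bijective_iff_injective_and_card _).2 ⟨by
      intro x y
      refine Fin.addCases (fun x => ?_) (fun x => Fin.cases ?_ (fun x => ?_) x) x <;>
      refine Fin.addCases (fun y => ?_) (fun y => Fin.cases ?_ (fun y => ?_) y) y <;>
      simp [Fin.ext_iff] <;> omega, by simp [add_assoc]⟩)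

/-- The extension of a bijection of indices by a fixed first index. -/
def extendIndex {j k : ℕ} (σ : Fin j ≃ Fin k) : Fin (j + 1) ≃ Fin (k + 1) :=
  Equiv.ofBijective (Fin.cases 0 fun s => (σ s).succ)
    ((Fintype.bijective_iff_injective_and_card _).2 ⟨by
      intro x y
      refine Fin.cases ?_ (fun x => ?_) x <;> refine Fin.cases ?_ (fun y => ?_) y <;>
      simp [(Fin.succ_ne_zero _).symm], by simpa using Fintype.card_congr σ⟩)

/-- The permutation of indices that moves the first index behind the next two. -/
def rotateThree (k : ℕ) : Fin (k + 3) ≃ Fin (k + 3) where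
  toFun := Fin.cases (Fin.succ (Fin.succ 0))
    (Fin.cases 0 (Fin.cases (Fin.succ 0) fun s => s.succ.succ.succ))
  invFun := Fin.cases (Fin.succ 0)
    (Fin.cases (Fin.succ (Fin.succ 0)) (Fin.cases 0 fun s => s.succ.succ.succ))
  left_inv := Fin.cases rfl (Fin.cases rfl (Fin.cases rfl fun _ => rfl))
  right_inv := Fin.cases rfl (Fin.cases rfl (Fin.cases rfl fun _ => rfl))

/-- Structural induction on the expression. Since the derivative index must come first, the product,
reindexing and contraction cases each need a permutation of slots. -/
theorem exists_isCovDeriv {k : ℕ} (A : TensorInvariant k) : ∃ B, IsCovDeriv A B := by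
  induction A with
  | nablaRm N => exact ⟨nablaRm (N + 1), fun ι _ _ E _ _ b U h hh y hy p a => rfl⟩
  | metric =>
    -- The zero invariant of rank 3, written as zero times an arbitrary expression of that rank; the
    -- case of the constant 1 uses the same device in rank 1.
    refine ⟨smul 0 (contract (nablaRm 1)), fun ι _ _ E _ _ b U h hh y hy p a => ?_⟩
    change (0 : ℝ) * _ = _
    rw [zero_mul]
    exact (hh.covDeriv_metric hy p a).symm
  | one =>
    refine ⟨smul 0 (contract (contract (nablaRm 1))), fun ι _ _ E _ _ b U h hh y hy p a => ?_⟩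
    change (0 : ℝ) * _ = _
    rw [zero_mul, covDeriv_cons]
    simp [eval, partialDeriv_const]
  | @tensor j k A B hA hB =>
    obtain ⟨A', hA⟩ := hA
    obtain ⟨B', hB⟩ := hB
    refine ⟨add (reindex (finCongr (Nat.add_right_comm j 1 k)) (tensor A' B))
      (reindex (shiftSecond j k) (tensor A B')), fun ι _ _ E _ _ b U h hh y hy p a => ?_⟩
    have hd := fun {k : ℕ} (A : TensorInvariant k) a =>
      differentiableAt_of_contDiffOn (hh.smooth_eval (b := b) A a) hh.isOpen hy
    have := covDeriv_tensor (b := b) (h := h) (hd A) (hd B) p a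
    simp only [eval] at this ⊢
    rw [this, ← hA ι E b U h hh y hy, ← hB ι E b U h hh y hy]
    congr 3
    · ext s
      refine Fin.cases ?_ (fun s => ?_) s
      · rfl
      · rfl
    · ext s
      have : (finCongr (Nat.add_right_comm j 1 k)) (Fin.natAdd (j + 1) s)
        = (Fin.natAdd j s).succ := by ext; simp; omega
      rw [this, Fin.cons_succ]
    · ext s
      simp [shiftSecond]
    · ext s
      refine Fin.cases ?_ (fun s => ?_) s
      · simp [shiftSecond]
      · simp [shiftSecond]
  | reindex σ A hA =>
    obtain ⟨A', hA⟩ := hA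
    refine ⟨reindex (extendIndex σ) A', fun ι _ _ E _ _ b U h hh y hy p a => ?_⟩
    have := covDeriv_reindex (b := b) (h := h) (y := y) σ (A.eval b h) p a
    simp only [eval] at this ⊢
    rw [this, ← hA ι E b U h hh y hy]
    congr 1
    ext s
    refine Fin.cases ?_ (fun s => ?_) s <;> simp [extendIndex]
  | @contract k A hA =>
    obtain ⟨A', hA⟩ := hA
    refine ⟨contract (reindex (rotateThree k) A'), fun ι _ _ E _ _ b U h hh y hy p a => ?_⟩
    have hd := fun a =>
      differentiableAt_of_contDiffOn (hh.smooth_eval (b := b) A a) hh.isOpen hy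
    have := hh.covDeriv_contract (b := b) hy hd p a
    simp only [eval] at this ⊢
    rw [this]
    refine Finset.sum_congr rfl fun i _ => Finset.sum_congr rfl fun j _ => ?_
    rw [← hA ι E b U h hh y hy]
    congr 2
    ext s
    refine Fin.cases ?_ (Fin.cases ?_ (Fin.cases ?_ (fun s => ?_))) s <;> rfl
  | add A B hA hB =>
    obtain ⟨A', hA⟩ := hA
    obtain ⟨B', hB⟩ := hB
    refine ⟨add A' B', fun ι _ _ E _ _ b U h hh y hy p a => ?_⟩
    have hd := fun {k : ℕ} (A : TensorInvariant k) a =>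
      differentiableAt_of_contDiffOn (hh.smooth_eval (b := b) A a) hh.isOpen hy
    simp only [eval, hA ι E b U h hh y hy, hB ι E b U h hh y hy, covDeriv_cons,
      partialDeriv_add (hd A a) (hd B a), mul_add, Finset.sum_add_distrib]
    ring
  | smul c A hA =>
    obtain ⟨A', hA⟩ := hA
    refine ⟨smul c A', fun ι _ _ E _ _ b U h hh y hy p a => ?_⟩
    simp only [eval, hA ι E b U h hh y hy, covDeriv_cons, partialDeriv_const_mul, mul_sub,
      Finset.mul_sum, mul_left_comm c]

end TensorInvariant

/-! ### The Laplacian, the scalar curvature and the factors as operations on invariants. -/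

section ScalarOperators

theorem ScalarInvariant.exists_laplacian (A : ScalarInvariant) : ∃ B : ScalarInvariant,
    ∀ (ι : Type) [Fintype ι] [DecidableEq ι] (E : Type) [NormedAddCommGroup E] [NormedSpace ℝ E]
    (b : Module.Basis ι ℝ E) (U : Set E) (h : E → Matrix ι ι ℝ), IsLocalMetric U h →
    ∀ y ∈ U, B.toFun b h y = laplacian b h (A.toFun b h) y := by
  obtain ⟨A', hA'⟩ := A.exists_isCovDeriv
  obtain ⟨A'', hA''⟩ := A'.exists_isCovDeriv
  refine ⟨.contract A'', fun ι _ _ E _ _ b U h hh y hy => ?_⟩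
  -- A scalar has no slots, so its first covariant derivative carries no Christoffel term; the
  -- second carries one, which is the correction in `laplacian`.
  have h1 : ∀ z ∈ U, ∀ j : ι, A'.eval b h z (Fin.cons j Fin.elim0)
      = partialDeriv b j (A.toFun b h) z := fun z hz j => by
    rw [hA' ι E b U h hh z hz, covDeriv_cons, Finset.univ_eq_empty, Finset.sum_empty, sub_zero]
    rfl
  simp only [laplacian, ScalarInvariant.toFun, TensorInvariant.eval]
  refine Finset.sum_congr rfl fun i _ => Finset.sum_congr rfl fun j _ => ?_
  congr 1
  refine (hA'' ι E b U h hh y hy i (Fin.cons j Fin.elim0)).trans ?_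
  rw [covDeriv_cons, partialDeriv_congr hh.isOpen (fun z hz => h1 z hz j) hy]
  congr 1
  rw [Fin.sum_univ_one]
  refine Finset.sum_congr rfl fun m _ => ?_
  rw [Fin.update_cons_zero, h1 y hy]
  rfl

/-- The permutation of the indices of `R_{icjd}` that brings `c`, `d` to the front. -/
def ricciIndex : Fin 4 ≃ Fin 4 :=
  Equiv.ofBijective ![2, 0, 3, 1] (by decide)

/-- The scalar curvature as a scalar Riemannian invariant. -/
def scalarCurvatureInvariant : ScalarInvariant :=
  .contract (.contract (.reindex ricciIndex (.nablaRm 0)))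

theorem toFun_scalarCurvatureInvariant {ι : Type} [Fintype ι] [DecidableEq ι] {E : Type}
    [NormedAddCommGroup E] [NormedSpace ℝ E] (b : Module.Basis ι ℝ E) {U : Set E}
    {h : E → Matrix ι ι ℝ} (hh : IsLocalMetric U h) {y : E} (hy : y ∈ U) :
    ScalarInvariant.toFun scalarCurvatureInvariant b h y = scalarCurvature b h y := by
  -- The inverse metric undoes the lowering of the last curvature index.
  have key : ∀ i j, ∑ c, ∑ d, (h y)⁻¹ c d * riemann b h y ![i, c, j, d] = ricci b h i j y := by
    intro i j
    refine Finset.sum_congr rfl fun c _ => ?_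
    have : ∀ d, (h y)⁻¹ c d * riemann b h y ![i, c, j, d]
        = ∑ e, curvature b h i c j e y * (h y e d * (h y)⁻¹ d c) := fun d => by
      simp only [riemann, Finset.mul_sum]
      refine Finset.sum_congr rfl fun e _ => ?_
      rw [hh.inv_symm hy c d]
      simp only [Matrix.cons_val]
      ring
    simp only [this]
    rw [Finset.sum_comm]
    simp only [← Finset.mul_sum, hh.sum_mul_inv hy, mul_ite, mul_one, mul_zero,
      Finset.sum_ite_eq', Finset.mem_univ, if_true]
  simp only [scalarCurvature, ← key]
  simp only [scalarCurvatureInvariant, ScalarInvariant.toFun, TensorInvariant.eval]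
  refine Finset.sum_congr rfl fun i _ => Finset.sum_congr rfl fun j _ => ?_
  congr 1

theorem ScalarInvariant.exists_isStraightProduct (n : ℕ) (k : ℝ) (L : List ℕ)
    (A : ScalarInvariant) : ∃ B, ScalarInvariant.IsStraightProduct n k L A B := by
  induction L with
  | nil => exact ⟨A, fun ι _ _ E _ _ b U h hh y hy => rfl⟩
  | cons j L ih =>
    obtain ⟨B, hB⟩ := ih
    obtain ⟨C, hC⟩ := B.exists_laplacian
    -- The extra division by `2(n - 1)` turns the scalar curvature into `J`; `n` stays a fixed
    -- number in every dimension.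
    refine ⟨.add C (.smul (-(4 * (k + j) * ((n : ℝ) - 2 * k - 2 * j - 1) / n
      / (2 * ((n : ℝ) - 1)))) (.tensor scalarCurvatureInvariant B)),
      fun ι _ _ E _ _ b U h hh y hy => ?_⟩
    rw [List.foldr_cons, ← straightFactor_congr n k j hh.isOpen
      (fun z hz => hB ι E b U h hh z hz) hy]
    have hs := toFun_scalarCurvatureInvariant b hh hy
    simp only [straightFactor, ← hC ι E b U h hh y hy, schoutenJ, ← hs]
    simp only [ScalarInvariant.toFun, TensorInvariant.eval]
    have e : ∀ f : Fin 0 → ι, f = Fin.elim0 := fun f => Subsingleton.elim _ _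
    rw [e (fun s => Fin.elim0 (Fin.castAdd 0 s)), e (fun s => Fin.elim0 (Fin.natAdd 0 s))]
    ring

end ScalarOperators

/-! ### Products of factors as polynomials in the Laplacian, and their coefficients. -/

section LaplacianPolynomials

open Polynomial

variable {ι : Type} [Fintype ι] [DecidableEq ι] {E : Type} [NormedAddCommGroup E] [NormedSpace ℝ E]
  {b : Module.Basis ι ℝ E} {h : E → Matrix ι ι ℝ} {U : Set E} {y : E}

theorem laplacian_const_mul (c : ℝ) (v : E → ℝ) :
    laplacian b h (fun z => c * v z) = fun z => c * laplacian b h v z := by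
  funext y
  have : ∀ j, partialDeriv b j (fun z => c * v z) = fun z => c * partialDeriv b j v z :=
    fun j => funext fun z => partialDeriv_const_mul c v j
  simp only [laplacian, this, partialDeriv_const_mul, Finset.mul_sum, mul_sub, mul_left_comm c]

namespace IsLocalMetric

theorem laplacian_add (hh : IsLocalMetric U h) {v w : E → ℝ} (hv : ContDiffOn ℝ ∞ v U)
    (hw : ContDiffOn ℝ ∞ w U) (hy : y ∈ U) :
    laplacian b h (fun z => v z + w z) y = laplacian b h v y + laplacian b h w y := by
  have hd := fun {f : E → ℝ} (hf : ContDiffOn ℝ ∞ f U) {z : E} (hz : z ∈ U) =>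
    differentiableAt_of_contDiffOn hf hh.isOpen hz
  have h1 : ∀ j, ∀ z ∈ U, partialDeriv b j (fun z => v z + w z) z
      = partialDeriv b j v z + partialDeriv b j w z :=
    fun j z hz => partialDeriv_add (hd hv hz) (hd hw hz) j
  have hp := fun {f : E → ℝ} (hf : ContDiffOn ℝ ∞ f U) j =>
    hd (contDiffOn_partialDeriv (b := b) hh.isOpen hf j) hy
  simp only [laplacian, partialDeriv_congr hh.isOpen (h1 _) hy, h1 _ y hy,
    partialDeriv_add (hp hv _) (hp hw _), mul_add, mul_sub, Finset.sum_add_distrib,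
    Finset.sum_sub_distrib]
  ring

theorem smooth_iterate_laplacian (hh : IsLocalMetric U h) {v : E → ℝ} (hv : ContDiffOn ℝ ∞ v U)
    (i : ℕ) : ContDiffOn ℝ ∞ ((laplacian b h)^[i] v) U := by
  induction i with
  | zero => exact hv
  | succ i ih =>
    rw [Function.iterate_succ_apply']
    exact hh.smooth_laplacian ih

end IsLocalMetric

/-- The polynomial `P(Δ)` in the Laplacian applied to a function. -/
def laplacianPolynomial (b : Module.Basis ι ℝ E) (h : E → Matrix ι ι ℝ) (P : ℝ[X]) (v : E → ℝ) :
    E → ℝ :=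
  fun y => P.sum fun i c => c * (laplacian b h)^[i] v y

theorem laplacianPolynomial_add (P Q : ℝ[X]) (v : E → ℝ) :
    laplacianPolynomial b h (P + Q) v
      = fun z => laplacianPolynomial b h P v z + laplacianPolynomial b h Q v z := by
  funext z
  exact sum_add_index _ _ _ (fun _ => zero_mul _) fun _ _ _ => add_mul _ _ _

theorem laplacianPolynomial_monomial (i : ℕ) (c : ℝ) (v : E → ℝ) :
    laplacianPolynomial b h (monomial i c) v = fun z => c * (laplacian b h)^[i] v z := by
  funext z
  exact sum_monomial_index _ _ (zero_mul _)

theorem laplacianPolynomial_C_mul (c : ℝ) (P : ℝ[X]) (v : E → ℝ) :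
    laplacianPolynomial b h (C c * P) v = fun z => c * laplacianPolynomial b h P v z := by
  induction P using Polynomial.induction_on' with
  | add P Q hP hQ =>
    rw [mul_add, laplacianPolynomial_add, laplacianPolynomial_add, hP, hQ]
    simp only [mul_add]
  | monomial i a =>
    rw [C_mul_monomial, laplacianPolynomial_monomial, laplacianPolynomial_monomial]
    simp only [mul_assoc]

theorem laplacianPolynomial_X_sub_C_mul (c : ℝ) (P : ℝ[X]) (v : E → ℝ) (y : E) :
    laplacianPolynomial b h ((X - C c) * P) v y
      = laplacianPolynomial b h (X * P) v y - c * laplacianPolynomial b h P v y := by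
  have : (X - C c) * P = X * P + C (-c) * P := by rw [C_neg]; ring
  rw [this, laplacianPolynomial_add, laplacianPolynomial_C_mul]
  ring

namespace IsLocalMetric

theorem smooth_laplacianPolynomial (hh : IsLocalMetric U h) (P : ℝ[X]) {v : E → ℝ}
    (hv : ContDiffOn ℝ ∞ v U) : ContDiffOn ℝ ∞ (laplacianPolynomial b h P v) U :=
  ContDiffOn.sum fun i _ => contDiffOn_const.mul (hh.smooth_iterate_laplacian hv i)

theorem laplacian_laplacianPolynomial (hh : IsLocalMetric U h) (P : ℝ[X]) {v : E → ℝ}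
    (hv : ContDiffOn ℝ ∞ v U) :
    ∀ y ∈ U, laplacian b h (laplacianPolynomial b h P v) y = laplacianPolynomial b h (X * P) v y := by
  induction P using Polynomial.induction_on' with
  | add P Q hP hQ =>
    intro y hy
    rw [mul_add, laplacianPolynomial_add, laplacianPolynomial_add, hh.laplacian_add
      (hh.smooth_laplacianPolynomial P hv) (hh.smooth_laplacianPolynomial Q hv) hy, hP y hy, hQ y hy]
  | monomial i a =>
    intro y _
    rw [laplacianPolynomial_monomial, laplacian_const_mul, X_mul_monomial,
      laplacianPolynomial_monomial, Function.iterate_succ_apply']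

/-- Where `J` is constant, the composition of the operators `Δ - (c_j / n) J` is a polynomial in
the Laplacian. -/
theorem foldr_straightFactor (hh : IsLocalMetric U h) {n : ℕ} (hn : n ≠ 0) {lam : ℝ} (k : ℝ)
    (hJ : ∀ y ∈ U, schoutenJ n b h y = n * lam) {v : E → ℝ} (hv : ContDiffOn ℝ ∞ v U)
    (L : List ℕ) : ∀ y ∈ U, L.foldr (straightFactor n k b h) v y = laplacianPolynomial b h
      (L.map fun j : ℕ => X - C (lam * (4 * (k + j) * ((n : ℝ) - 2 * k - 2 * j - 1)))).prod v y := by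
  induction L with
  | nil =>
    intro y _
    have : (1 : ℝ[X]) = monomial 0 1 := rfl
    rw [List.map_nil, List.prod_nil, this, laplacianPolynomial_monomial]
    exact (one_mul _).symm
  | cons j L ih =>
    intro y hy
    rw [List.foldr_cons, straightFactor_congr n k j hh.isOpen ih hy, List.map_cons,
      List.prod_cons, laplacianPolynomial_X_sub_C_mul, straightFactor, hh.laplacian_laplacianPolynomial _ hv y hy,
      hJ y hy]
    have : (n : ℝ) ≠ 0 := by exact_mod_cast hn
    congr 2
    field_simp

theorem foldr_straightFactor_perm (hh : IsLocalMetric U h) {n : ℕ} (hn : n ≠ 0) {lam : ℝ} (k : ℝ)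
    (hJ : ∀ y ∈ U, schoutenJ n b h y = n * lam) {v : E → ℝ} (hv : ContDiffOn ℝ ∞ v U)
    {L L' : List ℕ} (hL : L.Perm L') (hy : y ∈ U) :
    L.foldr (straightFactor n k b h) v y = L'.foldr (straightFactor n k b h) v y := by
  rw [hh.foldr_straightFactor hn k hJ hv L y hy, hh.foldr_straightFactor hn k hJ hv L' y hy,
    (hL.map _).prod_eq]

end IsLocalMetric

/-- The polynomial `∏ⱼ (X - 4 (k + j) (n - 2k - 2j - 1))`, `j < ℓ`. -/
def straightPolynomial (n : ℕ) (k : ℝ) (ℓ : ℕ) : ℝ[X] :=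
  ∏ j ∈ Finset.range ℓ, (X - C (4 * (k + j) * ((n : ℝ) - 2 * k - 2 * j - 1)))

theorem natDegree_straightPolynomial (n : ℕ) (k : ℝ) (ℓ : ℕ) :
    (straightPolynomial n k ℓ).natDegree = ℓ := by
  rw [straightPolynomial, natDegree_prod_of_monic _ _ fun _ _ => monic_X_sub_C _]
  simp only [natDegree_X_sub_C, Finset.sum_const, Finset.card_range, smul_eq_mul, mul_one]

theorem coeff_zero_straightPolynomial (n : ℕ) (k : ℝ) (ℓ : ℕ) :
    (straightPolynomial n k ℓ).coeff 0
      = (-4) ^ ℓ * ∏ j ∈ Finset.range ℓ, (k + j) * ((n : ℝ) - 2 * k - 2 * j - 1) := by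
  rw [coeff_zero_eq_eval_zero, straightPolynomial, eval_prod]
  conv_rhs => rw [← Finset.card_range ℓ, ← Finset.prod_const]
  rw [Finset.card_range, ← Finset.prod_mul_distrib]
  refine Finset.prod_congr rfl fun j _ => ?_
  simp only [eval_sub, eval_X, eval_C]
  ring

/-- All dependence on `λ` sits in the scaling of the roots. The `i`-th coefficient is thus that of
`straightPolynomial` times `λ^(ℓ-i)`, which makes the `a_i` independent of the metric. -/
theorem prod_map_range_eq_scaleRoots (n : ℕ) (k lam : ℝ) (ℓ : ℕ) :
    ((List.range ℓ).map fun j : ℕ =>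
      X - C (lam * (4 * (k + j) * ((n : ℝ) - 2 * k - 2 * j - 1)))).prod
      = (straightPolynomial n k ℓ).scaleRoots lam := by
  induction ℓ with
  | zero => simp [straightPolynomial]
  | succ ℓ ih =>
    rw [List.range_succ, List.map_append, List.prod_append, ih, straightPolynomial,
      straightPolynomial, Finset.prod_range_succ, mul_scaleRoots_of_noZeroDivisors,
      X_sub_C_scaleRoots, List.map_singleton, List.prod_singleton, mul_comm lam]

theorem IsLocalMetric.foldr_straightFactor_eq_sum (hh : IsLocalMetric U h) {n : ℕ} (hn : n ≠ 0)
    {lam : ℝ} (k : ℝ) (hJ : ∀ y ∈ U, schoutenJ n b h y = n * lam) {v : E → ℝ}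
    (hv : ContDiffOn ℝ ∞ v U) {ℓ : ℕ} {L : List ℕ} (hL : L.Perm (List.range ℓ)) (hy : y ∈ U) :
    L.foldr (straightFactor n k b h) v y
      = (-(4 / (n : ℝ)) * schoutenJ n b h y) ^ ℓ
          * (∏ j ∈ Finset.range ℓ, (k + j) * ((n : ℝ) - 2 * k - 2 * j - 1)) * v y
        + ∑ i ∈ Finset.Icc 1 ℓ, (straightPolynomial n k ℓ).coeff i * lam ^ (ℓ - i)
          * (laplacian b h)^[i] v y := by
  have hn' : (n : ℝ) ≠ 0 := by exact_mod_cast hn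
  rw [hh.foldr_straightFactor hn k hJ hv L y hy, (hL.map _).prod_eq, prod_map_range_eq_scaleRoots,
    laplacianPolynomial, sum_over_range _ fun _ => zero_mul _, natDegree_scaleRoots,
    -- The constant coefficient is split off: it becomes the leading term, the others the sum over
    -- `1 ≤ i ≤ ℓ`.
    natDegree_straightPolynomial, Finset.range_eq_Ico, Finset.sum_eq_sum_Ico_succ_bot (by omega)]
  congr 1
  · rw [coeff_scaleRoots, natDegree_straightPolynomial, coeff_zero_straightPolynomial, hJ y hy]
    have : -(4 / (n : ℝ)) * (n * lam) = -4 * lam := by field_simp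
    rw [this, mul_pow]
    simp only [Nat.sub_zero, Function.iterate_zero, id_eq]
    ring
  · refine Finset.sum_congr rfl fun i _ => ?_
    rw [coeff_scaleRoots, natDegree_straightPolynomial]

theorem prod_eq_factorial_ratio (n m ℓ : ℕ) (hm : 1 ≤ m) (hmn : 2 * m + 2 * ℓ ≤ n) :
    ∏ j ∈ Finset.range ℓ, (((m : ℝ) + j) * ((n : ℝ) - 2 * m - 2 * j - 1))
      = ((m + ℓ - 1).factorial * (n - 2 * m - 1).doubleFactorial : ℝ) /
              ((m - 1).factorial * (n - 2 * m - 2 * ℓ - 1).doubleFactorial : ℝ) := by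
  have hf : ∀ N : ℕ, (N.factorial : ℝ) ≠ 0 := fun N => by exact_mod_cast N.factorial_ne_zero
  have hd : ∀ N : ℕ, (N.doubleFactorial : ℝ) ≠ 0 := fun N => by
    exact_mod_cast (Nat.doubleFactorial_pos N).ne'
  induction ℓ with
  | zero =>
    simp only [Finset.range_zero, Finset.prod_empty, add_zero, mul_zero, Nat.sub_zero]
    rw [div_self (mul_ne_zero (hf _) (hd _))]
  | succ ℓ ih =>
    rw [Finset.prod_range_succ, ih (by omega)]
    have h1 : ((m + (ℓ + 1) - 1).factorial : ℝ) = (m + ℓ) * (m + ℓ - 1).factorial := by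
      obtain ⟨r, rfl⟩ := Nat.exists_eq_add_of_le hm
      have : 1 + r + (ℓ + 1) - 1 = (r + ℓ) + 1 := by omega
      rw [this, Nat.factorial_succ, show 1 + r + ℓ - 1 = r + ℓ by omega]
      push_cast; ring
    have h2 : ((n - 2 * m - 2 * ℓ - 1).doubleFactorial : ℝ)
        = ((n : ℝ) - 2 * m - 2 * ℓ - 1) * (n - 2 * m - 2 * (ℓ + 1) - 1).doubleFactorial := by
      obtain ⟨r, rfl⟩ := Nat.exists_eq_add_of_le hmn
      cases r with
      | zero =>
        -- The boundary case `n = 2m + 2(ℓ + 1)`: truncated subtraction turns `-1` into `0`, and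
        -- `0!! = 1` realises the convention `(-1)!! = 1`.
        rw [show 2 * m + 2 * (ℓ + 1) + 0 - 2 * m - 2 * ℓ - 1 = 1 by omega,
          show 2 * m + 2 * (ℓ + 1) + 0 - 2 * m - 2 * (ℓ + 1) - 1 = 0 by omega]
        push_cast [Nat.doubleFactorial]; ring
      | succ r =>
        rw [show 2 * m + 2 * (ℓ + 1) + (r + 1) - 2 * m - 2 * ℓ - 1 = r + 2 by omega,
          show 2 * m + 2 * (ℓ + 1) + (r + 1) - 2 * m - 2 * (ℓ + 1) - 1 = r by omega]
        push_cast [Nat.doubleFactorial]; ring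
    have h3 := hd (n - 2 * m - 2 * ℓ - 1)
    rw [h1]
    rw [h2] at h3 ⊢
    have h4 := left_ne_zero_of_mul h3
    have h5 := right_ne_zero_of_mul h3
    have h6 := hf (m - 1)
    field_simp

end LaplacianPolynomials

/-! ### Behaviour under constant rescaling of the metric. -/

section Scaling

variable {ι : Type} [Fintype ι] [DecidableEq ι] {E : Type} [NormedAddCommGroup E] [NormedSpace ℝ E]
  {b : Module.Basis ι ℝ E} {h : E → Matrix ι ι ℝ} {U : Set E} {y : E} {s : ℝ}

namespace IsLocalMetric

theorem const_smul (hh : IsLocalMetric U h) (hs : s ≠ 0) : IsLocalMetric U fun y => s • h y where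
  isOpen := hh.isOpen
  smooth i j := contDiffOn_const.mul (hh.smooth i j)
  symm y hy i j := by simp [hh.symm y hy i j]
  nondegenerate y hy := by simp [hs, hh.nondegenerate y hy]

theorem inv_const_smul (hh : IsLocalMetric U h) (hs : s ≠ 0) (hy : y ∈ U) (i j : ι) :
    (s • h y)⁻¹ i j = s⁻¹ * (h y)⁻¹ i j := by
  have : (s • h y)⁻¹ = s⁻¹ • (h y)⁻¹ := by
    refine Matrix.inv_eq_right_inv ?_
    rw [Matrix.smul_mul, Matrix.mul_smul, Matrix.mul_nonsing_inv _ (hh.isUnit_det hy), smul_smul,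
      mul_inv_cancel₀ hs, one_smul]
  rw [this, Matrix.smul_apply, smul_eq_mul]

theorem christoffel_const_smul (hh : IsLocalMetric U h) (hs : s ≠ 0) (hy : y ∈ U) (c i j : ι) :
    christoffel b (fun y => s • h y) c i j y = christoffel b h c i j y := by
  simp only [christoffel, hh.inv_const_smul hs hy, Matrix.smul_apply, smul_eq_mul,
    partialDeriv_const_mul]
  congr 1
  refine Finset.sum_congr rfl fun l _ => ?_
  field_simp

theorem curvature_const_smul (hh : IsLocalMetric U h) (hs : s ≠ 0) (hy : y ∈ U) (i j c d : ι) :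
    curvature b (fun y => s • h y) i j c d y = curvature b h i j c d y := by
  have hc := fun c i j => fun z (hz : z ∈ U) => hh.christoffel_const_smul (b := b) hs hz c i j
  simp only [curvature, hc _ _ _ y hy, partialDeriv_congr hh.isOpen (hc _ _ _) hy]

theorem schoutenJ_const_smul (hh : IsLocalMetric U h) (hs : s ≠ 0) (hy : y ∈ U) (n : ℕ) :
    schoutenJ n b (fun y => s • h y) y = s⁻¹ * schoutenJ n b h y := by
  simp only [schoutenJ, scalarCurvature, ricci, hh.curvature_const_smul hs hy,
    hh.inv_const_smul hs hy, mul_assoc, ← Finset.mul_sum, mul_div_assoc]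

theorem laplacian_const_smul (hh : IsLocalMetric U h) (hs : s ≠ 0) (hy : y ∈ U) (v : E → ℝ) :
    laplacian b (fun y => s • h y) v y = s⁻¹ * laplacian b h v y := by
  simp only [laplacian, hh.christoffel_const_smul hs hy, hh.inv_const_smul hs hy, mul_assoc,
    ← Finset.mul_sum]

/-- The Christoffel symbols and `R_{ijc}{}^d` do not see a constant scale, so `Δ` and `J` each gain
one factor `s⁻¹` from the inverse metric. -/
theorem foldr_straightFactor_const_smul (hh : IsLocalMetric U h) (hs : s ≠ 0) (n : ℕ) (k : ℝ)
    {v w : E → ℝ} {r : ℝ} (hvw : ∀ y ∈ U, w y = r * v y) (L : List ℕ) :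
    ∀ y ∈ U, L.foldr (straightFactor n k b fun y => s • h y) w y
      = s⁻¹ ^ L.length * r * L.foldr (straightFactor n k b h) v y := by
  induction L with
  | nil => simpa using hvw
  | cons j L ih =>
    intro y hy
    rw [List.foldr_cons, straightFactor_congr n k j hh.isOpen ih hy, List.foldr_cons,
      straightFactor, straightFactor, laplacian_const_mul]
    simp only [hh.laplacian_const_smul hs hy,
      hh.schoutenJ_const_smul hs hy, List.length_cons]
    ring

end IsLocalMetric

end Scaling

/-! ### The cone metric in coordinates: inverse, Christoffel symbols, homogeneous functions. -/

section ConeMetric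

variable {ι : Type} {E : Type} [NormedAddCommGroup E] [NormedSpace ℝ E]
  {b : Module.Basis ι ℝ E} {h : E → Matrix ι ι ℝ} {U : Set E} {lam : ℝ}

/-- The basis `∂_t, ∂_i, ∂_ρ` of `ℝ × E × ℝ`. -/
abbrev coneBasis (b : Module.Basis ι ℝ E) : Module.Basis (Unit ⊕ (ι ⊕ Unit)) ℝ (ℝ × E × ℝ) :=
  (Module.Basis.singleton Unit ℝ).prod (b.prod (Module.Basis.singleton Unit ℝ))

theorem partialDeriv_cone_t {F : ℝ × E × ℝ → ℝ} {q : ℝ × E × ℝ} (hF : DifferentiableAt ℝ F q) :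
    partialDeriv (coneBasis b) (.inl ()) F q = deriv (fun s => F (s, q.2)) q.1 := by
  have h1 : HasDerivAt (fun s : ℝ => (s, q.2)) (1, 0) q.1 :=
    (hasDerivAt_id q.1).prodMk (hasDerivAt_const _ _)
  have h2 := HasFDerivAt.comp_hasDerivAt (x := q.1) (f := fun s : ℝ => (s, q.2)) (l := F)
    (l' := fderiv ℝ F q) hF.hasFDerivAt h1
  refine Eq.trans ?_ h2.deriv.symm
  simp [partialDeriv]

theorem partialDeriv_cone_r {F : ℝ × E × ℝ → ℝ} {q : ℝ × E × ℝ} (hF : DifferentiableAt ℝ F q) :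
    partialDeriv (coneBasis b) (.inr (.inr ())) F q
      = deriv (fun s => F (q.1, q.2.1, s)) q.2.2 := by
  have h1 : HasDerivAt (fun s : ℝ => (q.1, q.2.1, s)) (0, 0, 1) q.2.2 :=
    (hasDerivAt_const _ _).prodMk ((hasDerivAt_const _ _).prodMk (hasDerivAt_id q.2.2))
  have h2 := HasFDerivAt.comp_hasDerivAt (x := q.2.2) (f := fun s : ℝ => (q.1, q.2.1, s)) (l := F)
    (l' := fderiv ℝ F q) hF.hasFDerivAt h1
  refine Eq.trans ?_ h2.deriv.symm
  simp [partialDeriv]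

theorem partialDeriv_cone_x {F : ℝ × E × ℝ → ℝ} {q : ℝ × E × ℝ} (hF : DifferentiableAt ℝ F q)
    (i : ι) : partialDeriv (coneBasis b) (.inr (.inl i)) F q
      = partialDeriv b i (fun z => F (q.1, z, q.2.2)) q.2.1 := by
  have h1 : HasFDerivAt (fun z : E => (q.1, z, q.2.2)) _ q.2.1 :=
    (hasFDerivAt_const q.1 _).prodMk ((hasFDerivAt_id (𝕜 := ℝ) q.2.1).prodMk
      (hasFDerivAt_const q.2.2 _))
  have h2 := HasFDerivAt.comp (x := q.2.1) (f := fun z : E => (q.1, z, q.2.2)) (g := F)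
    (g' := fderiv ℝ F q) hF.hasFDerivAt h1
  have h3 : fderiv ℝ (fun z => F (q.1, z, q.2.2)) q.2.1 = _ := h2.fderiv
  simp [partialDeriv, h3]

/-- The points `(t, x, ρ)` with `t > 0`, `x ∈ U` and `1 + λ ρ > 0`. -/
def coneDomain {E : Type} (U : Set E) (lam : ℝ) : Set (ℝ × E × ℝ) :=
  {q | 0 < q.1 ∧ q.2.1 ∈ U ∧ 0 < 1 + lam * q.2.2}

theorem contDiffOn_base {f : E → ℝ} (hf : ContDiffOn ℝ ∞ f U) :
    ContDiffOn ℝ ∞ (fun q : ℝ × E × ℝ => f q.2.1) (coneDomain U lam) :=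
  hf.comp (by fun_prop) fun _ hq => hq.2.1

theorem isOpen_coneDomain {E : Type} [NormedAddCommGroup E] {U : Set E} {lam : ℝ} (hU : IsOpen U) : IsOpen (coneDomain U lam) := by
  refine (isOpen_lt continuous_const continuous_fst).inter (IsOpen.inter ?_ ?_)
  · exact hU.preimage (continuous_fst.comp continuous_snd)
  · exact isOpen_lt continuous_const
      (show Continuous fun q : ℝ × E × ℝ => 1 + lam * q.2.2 by fun_prop)

/-- The function `τ ^ w u`, where `τ = t (1 + λ ρ)`. -/
def homogeneousExtension (lam w : ℝ) (u : E → ℝ) (q : ℝ × E × ℝ) : ℝ :=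
  (q.1 * (1 + lam * q.2.2)) ^ w * u q.2.1

theorem contDiffOn_homogeneousExtension (w : ℝ) {u : E → ℝ} (hu : ContDiffOn ℝ ∞ u U) :
    ContDiffOn ℝ ∞ (homogeneousExtension lam w u) (coneDomain U lam) :=
  ContDiffOn.mul (ContDiffOn.rpow_const_of_ne (by fun_prop) fun q hq =>
    (mul_pos hq.1 hq.2.2).ne') (contDiffOn_base hu)

/-- Logarithmic derivatives of `τ^w`: `∂_t log τ = 1/t` and `∂_ρ log τ = λ/(1 + λρ)`. The exponent
is real, hence the positivity built into `coneDomain`. -/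
theorem partialDeriv_homogeneousExtension (hU : IsOpen U) (w : ℝ) {u : E → ℝ}
    (hu : ContDiffOn ℝ ∞ u U) {q : ℝ × E × ℝ} (hq : q ∈ coneDomain U lam) :
    partialDeriv (coneBasis b) (.inl ()) (homogeneousExtension lam w u) q
      = w / q.1 * homogeneousExtension lam w u q ∧
    (∀ i, partialDeriv (coneBasis b) (.inr (.inl i)) (homogeneousExtension lam w u) q
      = homogeneousExtension lam w (partialDeriv b i u) q) ∧
    partialDeriv (coneBasis b) (.inr (.inr ())) (homogeneousExtension lam w u) q
      = w * lam / (1 + lam * q.2.2) * homogeneousExtension lam w u q := by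
  have hd := differentiableAt_of_contDiffOn (contDiffOn_homogeneousExtension (lam := lam) w hu)
    (isOpen_coneDomain hU) hq
  obtain ⟨ht, hx, hr⟩ := hq
  have hp := mul_pos ht hr
  have key : (q.1 * (1 + lam * q.2.2)) ^ (w - 1)
      = (q.1 * (1 + lam * q.2.2)) ^ w / (q.1 * (1 + lam * q.2.2)) := Real.rpow_sub_one hp.ne' w
  refine ⟨?_, fun i => ?_, ?_⟩
  · rw [partialDeriv_cone_t hd]
    have : HasDerivAt (fun s => (s * (1 + lam * q.2.2)) ^ w * u q.2.1)
        (1 * (1 + lam * q.2.2) * w * (q.1 * (1 + lam * q.2.2)) ^ (w - 1) * u q.2.1) q.1 :=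
      (((hasDerivAt_id' q.1).mul_const _).rpow_const (Or.inl hp.ne')).mul_const _
    simp only [homogeneousExtension]
    rw [this.deriv, key]
    field_simp
  · rw [partialDeriv_cone_x hd]
    exact partialDeriv_const_mul ((q.1 * (1 + lam * q.2.2)) ^ w) u i
  · rw [partialDeriv_cone_r hd]
    have : HasDerivAt (fun s => (q.1 * (1 + lam * s)) ^ w * u q.2.1)
        (q.1 * (lam * 1) * w * (q.1 * (1 + lam * q.2.2)) ^ (w - 1) * u q.2.1) q.2.2 :=
      (((((hasDerivAt_id' q.2.2).const_mul lam).const_add 1).const_mul q.1).rpow_const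
        (Or.inl hp.ne')).mul_const _
    simp only [homogeneousExtension]
    rw [this.deriv, key]
    field_simp

variable [Fintype ι] [DecidableEq ι]

/-- The components of `2 ρ dt² + 2 t dt dρ + t² (1 + λ ρ)² h`. -/
def coneMetric (h : E → Matrix ι ι ℝ) (lam : ℝ) (q : ℝ × E × ℝ) :
    Matrix (Unit ⊕ (ι ⊕ Unit)) (Unit ⊕ (ι ⊕ Unit)) ℝ :=
  Matrix.of fun
    | .inl _, .inl _ => 2 * q.2.2
    | .inl _, .inr (.inl _) => 0
    | .inl _, .inr (.inr _) => q.1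
    | .inr (.inl _), .inl _ => 0
    | .inr (.inl i), .inr (.inl j) => q.1 ^ 2 * (1 + lam * q.2.2) ^ 2 * h q.2.1 i j
    | .inr (.inl _), .inr (.inr _) => 0
    | .inr (.inr _), .inl _ => q.1
    | .inr (.inr _), .inr (.inl _) => 0
    | .inr (.inr _), .inr (.inr _) => 0

/-- The components of the inverse of `coneMetric`. -/
def coneInverse (h : E → Matrix ι ι ℝ) (lam : ℝ) (q : ℝ × E × ℝ) :
    Matrix (Unit ⊕ (ι ⊕ Unit)) (Unit ⊕ (ι ⊕ Unit)) ℝ :=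
  Matrix.of fun
    | .inl _, .inl _ => 0
    | .inl _, .inr (.inl _) => 0
    | .inl _, .inr (.inr _) => 1 / q.1
    | .inr (.inl _), .inl _ => 0
    | .inr (.inl i), .inr (.inl j) => 1 / (q.1 ^ 2 * (1 + lam * q.2.2) ^ 2) * (h q.2.1)⁻¹ i j
    | .inr (.inl _), .inr (.inr _) => 0
    | .inr (.inr _), .inl _ => 1 / q.1
    | .inr (.inr _), .inr (.inl _) => 0
    | .inr (.inr _), .inr (.inr _) => -2 * q.2.2 / q.1 ^ 2

/-- The Christoffel symbols of `coneMetric`. -/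
def coneChristoffel (b : Module.Basis ι ℝ E) (h : E → Matrix ι ι ℝ) (lam : ℝ) :
    Unit ⊕ (ι ⊕ Unit) → Unit ⊕ (ι ⊕ Unit) → Unit ⊕ (ι ⊕ Unit) → ℝ × E × ℝ → ℝ
  | .inl _, .inr (.inl i), .inr (.inl j) => fun q => -lam * q.1 * (1 + lam * q.2.2) * h q.2.1 i j
  | .inr (.inl k), .inl _, .inr (.inl i) => fun q => if k = i then 1 / q.1 else 0
  | .inr (.inl k), .inr (.inl i), .inl _ => fun q => if k = i then 1 / q.1 else 0
  | .inr (.inl k), .inr (.inl i), .inr (.inl j) => fun q => christoffel b h k i j q.2.1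
  | .inr (.inl k), .inr (.inl i), .inr (.inr _) =>
      fun q => if k = i then lam / (1 + lam * q.2.2) else 0
  | .inr (.inl k), .inr (.inr _), .inr (.inl i) =>
      fun q => if k = i then lam / (1 + lam * q.2.2) else 0
  | .inr (.inr _), .inl _, .inr (.inr _) => fun q => 1 / q.1
  | .inr (.inr _), .inr (.inr _), .inl _ => fun q => 1 / q.1
  | .inr (.inr _), .inr (.inl i), .inr (.inl j) =>
      fun q => -(1 - lam ^ 2 * q.2.2 ^ 2) * h q.2.1 i j
  | _, _, _ => fun _ => 0

theorem coneMetric_mul_coneInverse (hh : IsLocalMetric U h) {q : ℝ × E × ℝ}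
    (hq : q ∈ coneDomain U lam) : coneMetric h lam q * coneInverse h lam q = 1 := by
  obtain ⟨ht, hx, hr⟩ := hq
  have ht := ht.ne'
  have hr := hr.ne'
  ext a c
  rw [Matrix.mul_apply]
  obtain ⟨⟩ | i | ⟨⟩ := a <;> obtain ⟨⟩ | j | ⟨⟩ := c <;>
    simp [coneMetric, coneInverse, Fintype.sum_sum_type, Matrix.one_apply]
  · field_simp
  · field_simp; ring
  · have h1 : ∀ l, q.1 ^ 2 * (1 + lam * q.2.2) ^ 2 * h q.2.1 i l *
        (((1 + lam * q.2.2) ^ 2)⁻¹ * (q.1 ^ 2)⁻¹ * (h q.2.1)⁻¹ l j)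
        = h q.2.1 i l * (h q.2.1)⁻¹ l j := fun l => by field_simp
    simp only [h1, hh.sum_mul_inv hx]
  · field_simp

theorem coneMetric_inv (hh : IsLocalMetric U h) {q : ℝ × E × ℝ} (hq : q ∈ coneDomain U lam) :
    (coneMetric h lam q)⁻¹ = coneInverse h lam q :=
  Matrix.inv_eq_right_inv (coneMetric_mul_coneInverse hh hq)

theorem IsLocalMetric.coneMetric (hh : IsLocalMetric U h) :
    IsLocalMetric (coneDomain U lam) (coneMetric h lam) where
  isOpen := isOpen_coneDomain hh.isOpen
  smooth a c := by
    obtain ⟨⟩ | i | ⟨⟩ := a <;> obtain ⟨⟩ | j | ⟨⟩ := c <;> simp only [_root_.coneMetric, Matrix.of_apply]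
    case inr.inl.inr.inl => exact ContDiffOn.mul (by fun_prop) (contDiffOn_base (hh.smooth i j))
    all_goals fun_prop
  symm q hq a c := by
    obtain ⟨⟩ | i | ⟨⟩ := a <;> obtain ⟨⟩ | j | ⟨⟩ := c <;> simp only [_root_.coneMetric, Matrix.of_apply]
    rw [hh.symm _ hq.2.1]
  nondegenerate q hq :=
    (Matrix.isUnit_det_of_right_inverse (coneMetric_mul_coneInverse hh hq)).ne_zero

/-- The first derivatives of the components of `coneMetric`. -/
theorem partialDeriv_coneMetric (hh : IsLocalMetric U h) {q : ℝ × E × ℝ}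
    (hq : q ∈ coneDomain U lam) :
    (∀ a c, partialDeriv (coneBasis b) (.inl ()) (fun z => coneMetric h lam z a c) q
      = deriv (fun s => coneMetric h lam (s, q.2) a c) q.1) ∧
    (∀ i a c, partialDeriv (coneBasis b) (.inr (.inl i)) (fun z => coneMetric h lam z a c) q
      = partialDeriv b i (fun z => coneMetric h lam (q.1, z, q.2.2) a c) q.2.1) ∧
    ∀ a c, partialDeriv (coneBasis b) (.inr (.inr ())) (fun z => coneMetric h lam z a c) q
      = deriv (fun s => coneMetric h lam (q.1, q.2.1, s) a c) q.2.2 := by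
  have hd := fun a c =>
    differentiableAt_of_contDiffOn (hh.coneMetric.smooth a c) hh.coneMetric.isOpen hq
  exact ⟨fun a c => partialDeriv_cone_t (hd a c), fun i a c => partialDeriv_cone_x (hd a c) i,
    fun a c => partialDeriv_cone_r (hd a c)⟩

theorem christoffel_coneMetric (hh : IsLocalMetric U h) {q : ℝ × E × ℝ}
    (hq : q ∈ coneDomain U lam) (c i j : Unit ⊕ (ι ⊕ Unit)) :
    christoffel (coneBasis b) (coneMetric h lam) c i j q = coneChristoffel b h lam c i j q := by
  obtain ⟨h1, h2, h3⟩ := partialDeriv_coneMetric (b := b) hh hq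
  have ht := hq.1.ne'
  have hr := hq.2.2.ne'
  have hs := hh.symm q.2.1 hq.2.1
  have hi : ∀ k i, ∑ l, (h q.2.1)⁻¹ k l * h q.2.1 i l = if k = i then 1 else 0 := fun k i => by
    simp only [hs i, hh.sum_inv_mul hq.2.1]
  have d1 : ∀ A : ℝ, deriv (fun s => s ^ 2 * (1 + lam * q.2.2) ^ 2 * A) q.1
      = 2 * q.1 * (1 + lam * q.2.2) ^ 2 * A := fun A => by simp
  have d2 : ∀ A : ℝ, deriv (fun s => q.1 ^ 2 * (1 + lam * s) ^ 2 * A) q.2.2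
      = 2 * q.1 ^ 2 * (1 + lam * q.2.2) * lam * A := fun A => by
    have : HasDerivAt (fun s => q.1 ^ 2 * (1 + lam * s) ^ 2 * A)
      (q.1 ^ 2 * (2 * (1 + lam * q.2.2) ^ 1 * (lam * 1)) * A) q.2.2 :=
      (((((hasDerivAt_id q.2.2).const_mul lam).const_add 1).pow 2).const_mul _).mul_const A
    rw [this.deriv]; ring
  have d3 : deriv (fun s : ℝ => 2 * s) q.2.2 = 2 := by simp
  have d4 : deriv (fun s : ℝ => s) q.1 = 1 := by simp
  -- The `t`- and `ρ`-derivatives of the base block are multiples of `h` itself; raising an index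
  -- gives a multiple of the identity.
  have key : ∀ (k i : ι) (α : ℝ), ∑ l, 1 / (q.1 ^ 2 * (1 + lam * q.2.2) ^ 2) * (h q.2.1)⁻¹ k l *
      (α * h q.2.1 i l) = if k = i then α / (q.1 ^ 2 * (1 + lam * q.2.2) ^ 2) else 0 := by
    intro k i α
    have : ∀ l, 1 / (q.1 ^ 2 * (1 + lam * q.2.2) ^ 2) * (h q.2.1)⁻¹ k l * (α * h q.2.1 i l)
      = α / (q.1 ^ 2 * (1 + lam * q.2.2) ^ 2) * ((h q.2.1)⁻¹ k l * h q.2.1 i l) := fun l => by ring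
    simp only [this, ← Finset.mul_sum, hi, mul_ite, mul_one, mul_zero]
  obtain ⟨⟩ | c | ⟨⟩ := c <;> obtain ⟨⟩ | i | ⟨⟩ := i <;> obtain ⟨⟩ | j | ⟨⟩ := j <;>
    simp only [christoffel, coneMetric_inv hh hq, Fintype.sum_sum_type, h1, h2, h3,
      Finset.univ_unique, PUnit.default_eq_unit, Finset.sum_singleton, coneChristoffel] <;>
    simp only [coneInverse, coneMetric, Matrix.of_apply, d1, d2, d3, d4, deriv_const, partialDeriv_const, partialDeriv_const_mul,
      add_zero, zero_add, sub_zero, zero_sub, mul_zero, zero_mul, Finset.sum_const_zero, sub_self,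
      key]
  -- With all indices on the base, the factor `t²(1 + λρ)²` cancels against its inverse and the
  -- symbol of `h` remains.
  case inr.inl.inr.inl.inr.inl =>
    congr 1
    refine Finset.sum_congr rfl fun l _ => ?_
    field_simp
  all_goals first
    | (split_ifs <;> field_simp <;> ring1)
    | (field_simp <;> ring1)

end ConeMetric

/-! ### Ricci curvature and Laplacian of the cone metric. -/

section ConeCurvature

variable {ι : Type} [Fintype ι] [DecidableEq ι] {E : Type} [NormedAddCommGroup E] [NormedSpace ℝ E]
  {b : Module.Basis ι ℝ E} {h : E → Matrix ι ι ℝ} {U : Set E} {lam : ℝ}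

/-- The first derivatives of the Christoffel symbols of `coneMetric`. -/
theorem partialDeriv_christoffel_coneMetric (hh : IsLocalMetric U h) {q : ℝ × E × ℝ}
    (hq : q ∈ coneDomain U lam) (c i j : Unit ⊕ (ι ⊕ Unit)) :
    partialDeriv (coneBasis b) (.inl ()) (christoffel (coneBasis b) (coneMetric h lam) c i j) q
      = deriv (fun s => coneChristoffel b h lam c i j (s, q.2)) q.1 ∧
    (∀ k, partialDeriv (coneBasis b) (.inr (.inl k))
        (christoffel (coneBasis b) (coneMetric h lam) c i j) q
      = partialDeriv b k (fun z => coneChristoffel b h lam c i j (q.1, z, q.2.2)) q.2.1) ∧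
    partialDeriv (coneBasis b) (.inr (.inr ()))
        (christoffel (coneBasis b) (coneMetric h lam) c i j) q
      = deriv (fun s => coneChristoffel b h lam c i j (q.1, q.2.1, s)) q.2.2 := by
  have hU : IsOpen (coneDomain U lam) := isOpen_coneDomain hh.isOpen
  have he : Set.EqOn (christoffel (coneBasis b) (coneMetric h lam) c i j)
      (coneChristoffel b h lam c i j) (coneDomain U lam) :=
    fun z hz => christoffel_coneMetric hh hz c i j
  have hd : DifferentiableAt ℝ (coneChristoffel b h lam c i j) q :=
    differentiableAt_of_contDiffOn
      ((hh.coneMetric.smooth_christoffel c i j).congr fun z hz => (he hz).symm) hU hq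
  refine ⟨?_, fun k => ?_, ?_⟩ <;> rw [partialDeriv_congr hU he hq]
  · exact partialDeriv_cone_t hd
  · exact partialDeriv_cone_x hd k
  · exact partialDeriv_cone_r hd

/-- Only the components paired with the nonzero blocks of `coneInverse` are computed: they are all
that the scalar curvature sees. -/
theorem ricci_coneMetric (hh : IsLocalMetric U h) {q : ℝ × E × ℝ}
    (hq : q ∈ coneDomain U lam) :
    ricci (coneBasis b) (coneMetric h lam) (.inl ()) (.inr (.inr ())) q = 0 ∧
    ricci (coneBasis b) (coneMetric h lam) (.inr (.inr ())) (.inl ()) q = 0 ∧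
    ricci (coneBasis b) (coneMetric h lam) (.inr (.inr ())) (.inr (.inr ())) q = 0 ∧
    ∀ i j, ricci (coneBasis b) (coneMetric h lam) (.inr (.inl i)) (.inr (.inl j)) q
      = ricci b h i j q.2.1 - 2 * lam * ((Fintype.card ι : ℝ) - 1) * h q.2.1 i j := by
  have h1 := fun c i j => (partialDeriv_christoffel_coneMetric (b := b) hh hq c i j).1
  have h2 := fun c i j => (partialDeriv_christoffel_coneMetric (b := b) hh hq c i j).2.1
  have h3 := fun c i j => (partialDeriv_christoffel_coneMetric (b := b) hh hq c i j).2.2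
  have ht := hq.1.ne'
  have hr := hq.2.2.ne'
  have d1 : ∀ A : ℝ, deriv (fun s => -lam * s * (1 + lam * q.2.2) * A) q.1
      = -lam * (1 + lam * q.2.2) * A := fun A => by simp
  have d2 : ∀ A : ℝ, deriv (fun s => -(1 - lam ^ 2 * s ^ 2) * A) q.2.2
      = 2 * lam ^ 2 * q.2.2 * A := fun A => by
    have : HasDerivAt (fun s => -(1 - lam ^ 2 * s ^ 2) * A)
      (-(-(lam ^ 2 * (2 * q.2.2 ^ 1 * 1))) * A) q.2.2 :=
      (((((hasDerivAt_id q.2.2).pow 2).const_mul (lam ^ 2)).const_sub 1).neg).mul_const A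
    rw [this.deriv]; ring
  have d3 : deriv (fun s => lam / (1 + lam * s)) q.2.2 = -lam ^ 2 / (1 + lam * q.2.2) ^ 2 := by
    have : HasDerivAt (fun s => lam / (1 + lam * s))
      ((0 * (1 + lam * q.2.2) - lam * (lam * 1)) / (1 + lam * q.2.2) ^ 2) q.2.2 :=
      (hasDerivAt_const _ _).div (((hasDerivAt_id q.2.2).const_mul lam).const_add 1) hr
    rw [this.deriv]; ring
  refine ⟨?_, ?_, ?_, fun i j => ?_⟩ <;>
  simp only [ricci, curvature, Fintype.sum_sum_type, Finset.univ_unique, PUnit.default_eq_unit,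
    Finset.sum_singleton, h1, h2, h3, christoffel_coneMetric hh hq] <;>
  simp only [coneChristoffel, deriv_const, d1, d2, d3, partialDeriv_const, mul_zero, zero_mul,
    sub_zero, zero_sub, add_zero, zero_add, neg_zero, if_true, Finset.sum_const_zero, mul_ite,
    ite_mul, Finset.sum_ite_eq, Finset.sum_ite_eq', Finset.mem_univ, Finset.sum_add_distrib,
    Finset.sum_sub_distrib, Finset.sum_neg_distrib, Finset.sum_const, Finset.card_univ,
    nsmul_eq_mul, sub_self]
  · field_simp; ring
  · ring
  · field_simp; ring
  -- The four sums make up the Ricci tensor of `h` and occur on both sides; the remaining terms are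
  -- multiples of `h`.
  · generalize ∑ x, partialDeriv b x (christoffel b h x i j) q.2.1 = S₁
    generalize ∑ x, partialDeriv b i (christoffel b h x x j) q.2.1 = S₂
    generalize ∑ x, ∑ y, christoffel b h y i j q.2.1 * christoffel b h x x y q.2.1 = S₃
    generalize ∑ x, ∑ y, christoffel b h y x j q.2.1 * christoffel b h x i y q.2.1 = S₄
    field_simp
    ring

/-- The scalar curvature of `coneMetric` vanishes over an Einstein metric. -/
theorem scalarCurvature_coneMetric (hh : IsLocalMetric U h) {q : ℝ × E × ℝ}
    (hq : q ∈ coneDomain U lam) (hE : ∀ i j, ricci b h i j q.2.1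
      = 2 * lam * ((Fintype.card ι : ℝ) - 1) * h q.2.1 i j) :
    scalarCurvature (coneBasis b) (coneMetric h lam) q = 0 := by
  obtain ⟨r1, r2, r3, r4⟩ := ricci_coneMetric (b := b) hh hq
  simp only [scalarCurvature, coneMetric_inv hh hq, Fintype.sum_sum_type, Finset.univ_unique,
    PUnit.default_eq_unit, Finset.sum_singleton, r1, r2, r3, r4, hE, sub_self]
  simp [coneInverse]

/-- The `tρ` and `ρρ` terms together contribute `2λw(w - 1)`. The trace over the base block
contributes `Δu` and, through the symbols `Γ^t_{ij}` and `Γ^ρ_{ij}`, the term `2λwn`. -/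
theorem laplacian_coneMetric (hh : IsLocalMetric U h) (w : ℝ) {u : E → ℝ}
    (hu : ContDiffOn ℝ ∞ u U) {q : ℝ × E × ℝ} (hq : q ∈ coneDomain U lam) :
    laplacian (coneBasis b) (coneMetric h lam) (homogeneousExtension lam w u) q
      = homogeneousExtension lam (w - 2)
        (fun z => laplacian b h u z + 2 * lam * w * (w - 1 + Fintype.card ι) * u z) q := by
  have hU := isOpen_coneDomain (lam := lam) hh.isOpen
  have hp := fun {v : E → ℝ} (hv : ContDiffOn ℝ ∞ v U) {z : ℝ × E × ℝ}
    (hz : z ∈ coneDomain U lam) =>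
      partialDeriv_homogeneousExtension (b := b) (lam := lam) hh.isOpen w hv hz
  have hdu := fun i => contDiffOn_partialDeriv (b := b) hh.isOpen hu i
  obtain ⟨p1, p2, p3⟩ := hp hu hq
  have hF := differentiableAt_of_contDiffOn (contDiffOn_homogeneousExtension (lam := lam) w hu)
    hU hq
  have ht := hq.1.ne'
  have hr := hq.2.2.ne'
  have c1 : DifferentiableAt ℝ (fun z : ℝ × E × ℝ => w / z.1) q := by
    fun_prop (disch := assumption)
  have c3 : DifferentiableAt ℝ (fun z : ℝ × E × ℝ => w * lam / (1 + lam * z.2.2)) q := by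
    fun_prop (disch := assumption)
  have d3 : deriv (fun s => w * lam / (1 + lam * s)) q.2.2
      = -(w * lam ^ 2) / (1 + lam * q.2.2) ^ 2 := by
    have : HasDerivAt (fun s => w * lam / (1 + lam * s))
      ((0 * (1 + lam * q.2.2) - w * lam * (lam * 1)) / (1 + lam * q.2.2) ^ 2) q.2.2 :=
      (hasDerivAt_const _ _).div (((hasDerivAt_id q.2.2).const_mul lam).const_add 1) hr
    rw [this.deriv]; ring
  have s1 : partialDeriv (coneBasis b) (.inl ())
      (partialDeriv (coneBasis b) (.inr (.inr ())) (homogeneousExtension lam w u)) q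
      = w * lam / (1 + lam * q.2.2) * (w / q.1) * homogeneousExtension lam w u q := by
    rw [partialDeriv_congr hU (fun z hz => (hp hu hz).2.2) hq, partialDeriv_mul c3 hF, p1,
      partialDeriv_cone_t c3]
    simp only [deriv_const]
    ring
  have s2 : partialDeriv (coneBasis b) (.inr (.inr ()))
      (partialDeriv (coneBasis b) (.inl ()) (homogeneousExtension lam w u)) q
      = w * lam / (1 + lam * q.2.2) * (w / q.1) * homogeneousExtension lam w u q := by
    rw [partialDeriv_congr hU (fun z hz => (hp hu hz).1) hq, partialDeriv_mul c1 hF, p3,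
      partialDeriv_cone_r c1]
    simp only [deriv_const]
    ring
  have s3 : partialDeriv (coneBasis b) (.inr (.inr ()))
      (partialDeriv (coneBasis b) (.inr (.inr ())) (homogeneousExtension lam w u)) q
      = w * (w - 1) * lam ^ 2 / (1 + lam * q.2.2) ^ 2 * homogeneousExtension lam w u q := by
    rw [partialDeriv_congr hU (fun z hz => (hp hu hz).2.2) hq, partialDeriv_mul c3 hF, p3,
      partialDeriv_cone_r c3, d3]
    field_simp
    ring
  have s4 : ∀ i j, partialDeriv (coneBasis b) (.inr (.inl i))
      (partialDeriv (coneBasis b) (.inr (.inl j)) (homogeneousExtension lam w u)) q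
      = homogeneousExtension lam w (partialDeriv b i (partialDeriv b j u)) q := fun i j => by
    rw [partialDeriv_congr hU (fun z hz => (hp hu hz).2.1 j) hq, (hp (hdu j) hq).2.1]
  have hτ : (q.1 * (1 + lam * q.2.2)) ^ (w - 2)
      = (q.1 * (1 + lam * q.2.2)) ^ w / (q.1 * (1 + lam * q.2.2)) ^ 2 :=
    Real.rpow_sub_natCast (mul_ne_zero ht hr) w 2
  have hcard : ∑ i, ∑ j, (h q.2.1)⁻¹ i j * h q.2.1 i j = Fintype.card ι := by
    have : ∀ i, ∑ j, (h q.2.1)⁻¹ i j * h q.2.1 i j = 1 := fun i => by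
      refine Eq.trans ?_ ((hh.sum_inv_mul hq.2.1 i i).trans (if_pos rfl))
      exact Finset.sum_congr rfl fun j _ => by rw [hh.symm _ hq.2.1 i j]
    simp [this]
  set τ := (q.1 * (1 + lam * q.2.2)) ^ w with hτ'
  -- The three summands come from the `tρ`, `ρρ` and base blocks of the inverse metric; its `tt`
  -- block is zero.
  have lhs : laplacian (coneBasis b) (coneMetric h lam) (homogeneousExtension lam w u) q
      = 2 * (1 / q.1 * ((w * lam / (1 + lam * q.2.2) * (w / q.1)
          - 1 / q.1 * (w * lam / (1 + lam * q.2.2))) * (τ * u q.2.1)))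
        + -2 * q.2.2 / q.1 ^ 2 * (w * (w - 1) * lam ^ 2 / (1 + lam * q.2.2) ^ 2 * (τ * u q.2.1))
        + 1 / (q.1 ^ 2 * (1 + lam * q.2.2) ^ 2) * (τ * laplacian b h u q.2.1
          + (lam * q.1 * (1 + lam * q.2.2) * (w / q.1)
            + (1 - lam ^ 2 * q.2.2 ^ 2) * (w * lam / (1 + lam * q.2.2))) * (τ * u q.2.1)
            * ∑ i, ∑ j, (h q.2.1)⁻¹ i j * h q.2.1 i j) := by
    simp only [laplacian, coneMetric_inv hh hq, Fintype.sum_sum_type, Finset.univ_unique,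
      PUnit.default_eq_unit, Finset.sum_singleton, christoffel_coneMetric hh hq, p1, p2, p3, s1, s2,
      s3, s4]
    simp only [coneInverse, coneChristoffel, Matrix.of_apply, zero_mul, mul_zero, add_zero,
      zero_add, Finset.sum_const_zero, sub_zero, homogeneousExtension, ← hτ']
    have mid : ∀ i j, 1 / (q.1 ^ 2 * (1 + lam * q.2.2) ^ 2) * (h q.2.1)⁻¹ i j *
        (τ * partialDeriv b i (partialDeriv b j u) q.2.1 -
          (-lam * q.1 * (1 + lam * q.2.2) * h q.2.1 i j * (w / q.1 * (τ * u q.2.1)) +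
            (∑ c, christoffel b h c i j q.2.1 * (τ * partialDeriv b c u q.2.1) +
              -(1 - lam ^ 2 * q.2.2 ^ 2) * h q.2.1 i j
                * (w * lam / (1 + lam * q.2.2) * (τ * u q.2.1)))))
        = 1 / (q.1 ^ 2 * (1 + lam * q.2.2) ^ 2) * (τ * ((h q.2.1)⁻¹ i j *
            (partialDeriv b i (partialDeriv b j u) q.2.1 -
              ∑ c, christoffel b h c i j q.2.1 * partialDeriv b c u q.2.1))
          + (lam * q.1 * (1 + lam * q.2.2) * (w / q.1)
            + (1 - lam ^ 2 * q.2.2 ^ 2) * (w * lam / (1 + lam * q.2.2))) * (τ * u q.2.1)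
            * ((h q.2.1)⁻¹ i j * h q.2.1 i j)) := fun i j => by
      have : ∑ c, christoffel b h c i j q.2.1 * (τ * partialDeriv b c u q.2.1)
          = τ * ∑ c, christoffel b h c i j q.2.1 * partialDeriv b c u q.2.1 := by
        simp only [Finset.mul_sum, mul_left_comm τ]
      rw [this]
      ring
    simp only [mid, ← Finset.mul_sum, Finset.sum_add_distrib]
    ring
  rw [lhs, hcard, homogeneousExtension, hτ]
  field_simp
  ring

end ConeCurvature

/-! ### Locality in the metric, and the value of `J` for an Einstein metric. -/

section MetricCongruence

variable {ι : Type} [Fintype ι] [DecidableEq ι] {E : Type} [NormedAddCommGroup E] [NormedSpace ℝ E]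
  {b : Module.Basis ι ℝ E} {h h' : E → Matrix ι ι ℝ} {U : Set E} {y : E}

theorem IsLocalMetric.congr (hh : IsLocalMetric U h) (he : Set.EqOn h' h U) :
    IsLocalMetric U h' where
  isOpen := hh.isOpen
  smooth i j := (hh.smooth i j).congr fun y hy => by rw [he hy]
  symm y hy i j := by rw [he hy, hh.symm y hy]
  nondegenerate y hy := by rw [he hy]; exact hh.nondegenerate y hy

theorem christoffel_congr (hU : IsOpen U) (he : Set.EqOn h' h U) (c i j : ι) :
    Set.EqOn (christoffel b h' c i j) (christoffel b h c i j) U := by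
  intro y hy
  have h1 : ∀ p q, Set.EqOn (fun z => h' z p q) (fun z => h z p q) U := fun p q z hz => by
    simp only [he hz]
  simp only [christoffel, he hy, partialDeriv_congr hU (h1 _ _) hy]

theorem curvature_congr (hU : IsOpen U) (he : Set.EqOn h' h U) (i j c d : ι) :
    Set.EqOn (curvature b h' i j c d) (curvature b h i j c d) U := by
  intro y hy
  have h1 := fun c i j => christoffel_congr (b := b) hU he c i j
  have h2 := fun p c i j => partialDeriv_congr (b := b) hU (h1 c i j) hy p
  unfold curvature
  rw [h2, h2]
  congr 1
  refine Finset.sum_congr rfl fun e _ => ?_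
  rw [h1 _ _ _ hy, h1 _ _ _ hy, h1 _ _ _ hy, h1 _ _ _ hy]

theorem schoutenJ_congr (hU : IsOpen U) (he : Set.EqOn h' h U) (n : ℕ) :
    Set.EqOn (schoutenJ n b h') (schoutenJ n b h) U := by
  intro y hy
  have h1 := fun i j c d => curvature_congr (b := b) hU he i j c d hy
  unfold schoutenJ scalarCurvature ricci
  rw [he hy]
  congr 1
  refine Finset.sum_congr rfl fun i _ => Finset.sum_congr rfl fun j _ => ?_
  congr 1
  exact Finset.sum_congr rfl fun c _ => h1 _ _ _ _

theorem straightFactor_congr_metric (hU : IsOpen U) (he : Set.EqOn h' h U) (n : ℕ) (k : ℝ)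
    (j : ℕ) (v : E → ℝ) :
    Set.EqOn (straightFactor n k b h' j v) (straightFactor n k b h j v) U := by
  intro y hy
  unfold straightFactor
  rw [schoutenJ_congr hU he n hy]
  congr 1
  unfold laplacian
  rw [he hy]
  refine Finset.sum_congr rfl fun i _ => Finset.sum_congr rfl fun j _ => ?_
  congr 2
  exact Finset.sum_congr rfl fun c _ => by rw [christoffel_congr hU he _ _ _ hy]

theorem foldr_straightFactor_congr (hU : IsOpen U) (he : Set.EqOn h' h U) (n : ℕ) (k : ℝ)
    (v : E → ℝ) (L : List ℕ) : Set.EqOn (L.foldr (straightFactor n k b h') v)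
      (L.foldr (straightFactor n k b h) v) U := by
  induction L with
  | nil =>
    rw [List.foldr_nil, List.foldr_nil]
    exact fun _ _ => rfl
  | cons j L ih =>
    exact fun y hy => (straightFactor_congr n k j hU ih hy).trans
      (straightFactor_congr_metric hU he n k j _ hy)

theorem IsLocalMetric.smooth_foldr_straightFactor (hh : IsLocalMetric U h) (n : ℕ) (k : ℝ)
    {v : E → ℝ} (hv : ContDiffOn ℝ ∞ v U) (L : List ℕ) :
    ContDiffOn ℝ ∞ (L.foldr (straightFactor n k b h) v) U := by
  induction L with
  | nil => exact hv
  | cons j L ih =>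
    exact (hh.smooth_laplacian ih).sub ((contDiffOn_const.mul (hh.smooth_schoutenJ n)).mul ih)

/-- An Einstein metric with `Ric = 2 λ (n - 1) h` in dimension `n` has `J = n λ`. -/
theorem IsLocalMetric.schoutenJ_of_einstein (hh : IsLocalMetric U h) (hy : y ∈ U) {n : ℕ}
    (hn : 2 ≤ n) (hcard : Fintype.card ι = n) {lam : ℝ}
    (hE : ∀ i j, ricci b h i j y = 2 * lam * ((n : ℝ) - 1) * h y i j) :
    schoutenJ n b h y = n * lam := by
  have h1 : ∀ i, ∑ j, (h y)⁻¹ i j * h y i j = 1 := fun i => by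
    refine Eq.trans ?_ ((hh.sum_inv_mul hy i i).trans (if_pos rfl))
    exact Finset.sum_congr rfl fun j _ => by rw [hh.symm _ hy i j]
  have h2 : scalarCurvature b h y = 2 * lam * ((n : ℝ) - 1) * n := by
    simp only [scalarCurvature, hE, mul_left_comm _ (2 * lam * ((n : ℝ) - 1)), ← Finset.mul_sum, h1]
    simp [hcard]
  have h3 : (n : ℝ) - 1 ≠ 0 := by
    have : (2 : ℝ) ≤ n := by exact_mod_cast hn
    linarith
  rw [schoutenJ, h2]
  field_simp

end MetricCongruence

/-! ### Passing the factors from the cone to the base. -/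

section ConeStraightening

variable {ι : Type} [Fintype ι] [DecidableEq ι] {E : Type} [NormedAddCommGroup E] [NormedSpace ℝ E]
  {b : Module.Basis ι ℝ E} {h : E → Matrix ι ι ℝ} {U : Set E} {lam : ℝ} {n : ℕ}

/-- The operators in increasing order, applied to `τ ^ (-2k) u` on the cone. -/
theorem foldr_reverse_range_coneMetric (hh : IsLocalMetric U h) (hn : 2 ≤ n)
    (hcard : Fintype.card ι = n)
    (hE : ∀ y ∈ U, ∀ i j, ricci b h i j y = 2 * lam * ((n : ℝ) - 1) * h y i j) (k : ℝ)
    {u : E → ℝ} (hu : ContDiffOn ℝ ∞ u U) {V : Set (ℝ × E × ℝ)} (hV : IsOpen V)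
    (hVU : V ⊆ coneDomain U lam) {F : ℝ × E × ℝ → ℝ}
    (hF : Set.EqOn F (homogeneousExtension lam (-2 * k) u) V) (m : ℕ) :
    Set.EqOn ((List.range m).reverse.foldr
        (straightFactor n k (coneBasis b) (coneMetric h lam)) F)
      (homogeneousExtension lam (-2 * k - 2 * m)
        ((List.range m).reverse.foldr (straightFactor n k b h) u)) V := by
  induction m with
  | zero => simpa using hF
  | succ m ih =>
    intro q hq
    have hq' := hVU hq
    have hJ : schoutenJ n (coneBasis b) (coneMetric h lam) q = 0 := by
      rw [schoutenJ, scalarCurvature_coneMetric hh hq' (by simpa [hcard] using hE _ hq'.2.1),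
        zero_div]
    -- Reversing the list makes factor `m` outermost, so it meets a function of homogeneity exactly
    -- `-2k - 2m`, the one its constant is tuned to.
    rw [List.range_succ, List.reverse_append, List.reverse_singleton, List.singleton_append,
      List.foldr_cons, List.foldr_cons, straightFactor, hJ, laplacian_congr hV ih hq,
      laplacian_coneMetric hh _ (hh.smooth_foldr_straightFactor n k hu _) hq', hcard]
    have hw : -2 * k - 2 * (m : ℝ) - 2 = -2 * k - 2 * ((m + 1 : ℕ) : ℝ) := by push_cast; ring
    rw [hw]
    -- With `J = nλ` the claim becomes `2w(w - 1 + n) = -4(k + m)(n - 2k - 2m - 1)` for `w = -2k -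
    -- 2m`.
    simp only [homogeneousExtension, straightFactor,
      hh.schoutenJ_of_einstein hq'.2.1 hn hcard (hE _ hq'.2.1)]
    have hn0 : (n : ℝ) ≠ 0 := by
      have : n ≠ 0 := by omega
      exact_mod_cast this
    field_simp
    ring

/-- On the cone and on the base `J` is constant, so the factors may be permuted into the order in
which the homogeneities match. -/
theorem foldr_coneMetric (hh : IsLocalMetric U h) (hn : 2 ≤ n) (hcard : Fintype.card ι = n)
    (hE : ∀ y ∈ U, ∀ i j, ricci b h i j y = 2 * lam * ((n : ℝ) - 1) * h y i j) (k : ℝ)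
    {u : E → ℝ} (hu : ContDiffOn ℝ ∞ u U) {V : Set (ℝ × E × ℝ)} (hV : IsOpen V)
    (hVU : V ⊆ coneDomain U lam) {F : ℝ × E × ℝ → ℝ} (hFs : ContDiffOn ℝ ∞ F (coneDomain U lam))
    (hF : Set.EqOn F (homogeneousExtension lam (-2 * k) u) V) {ℓ : ℕ} {L : List ℕ}
    (hL : L.Perm (List.range ℓ)) :
    Set.EqOn (L.foldr (straightFactor n k (coneBasis b) (coneMetric h lam)) F)
      (homogeneousExtension lam (-2 * k - 2 * ℓ) (L.foldr (straightFactor n k b h) u)) V := by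
  intro q hq
  have hq' := hVU hq
  have hn0 : n ≠ 0 := by omega
  have hL' : L.Perm (List.range ℓ).reverse := hL.trans (List.reverse_perm _).symm
  -- Written as `n * 0` so that the commutation lemma applies to the cone with `lam = 0`.
  have hJ : ∀ z ∈ coneDomain U lam,
      schoutenJ n (coneBasis b) (coneMetric h lam) z = n * 0 := fun z hz => by
    rw [schoutenJ, scalarCurvature_coneMetric hh hz (by simpa [hcard] using hE _ hz.2.1),
      zero_div, mul_zero]
  rw [hh.coneMetric.foldr_straightFactor_perm hn0 k hJ hFs hL' hq',
    foldr_reverse_range_coneMetric hh hn hcard hE k hu hV hVU hF ℓ hq]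
  simp only [homogeneousExtension]
  rw [hh.foldr_straightFactor_perm hn0 k
    (fun y hy => hh.schoutenJ_of_einstein hy hn hcard (hE y hy)) hu hL' hq'.2.1]

end ConeStraightening

/-! ### From metrics on manifolds to their components in charts. -/

section ManifoldComponents

variable {n : ℕ} {M : Type u} [TopologicalSpace M]
  {e : OpenPartialHomeomorph M (EuclideanSpace ℝ (Fin n))}

theorem ambientChart_extend_symm (e : OpenPartialHomeomorph M (EuclideanSpace ℝ (Fin n))) :
    ((ambientChart e).extend (ambientModel n)).symm
      = fun q : ℝ × EuclideanSpace ℝ (Fin n) × ℝ => (q.1, e.symm q.2.1, q.2.2) :=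
  rfl

variable [ChartedSpace (EuclideanSpace ℝ (Fin n)) M]

theorem mdifferentiable_of_mem_maximalAtlas (he : e ∈ IsManifold.maximalAtlas (𝓡 n) ∞ M) :
    e.MDifferentiable (𝓡 n) (𝓡 n) :=
  ⟨(contMDiffOn_of_mem_maximalAtlas he).mdifferentiableOn (by simp),
    (contMDiffOn_symm_of_mem_maximalAtlas he).mdifferentiableOn (by simp)⟩

theorem mfderiv_ambientChart_symm (he : e ∈ IsManifold.maximalAtlas (𝓡 n) ∞ M)
    {q : ℝ × EuclideanSpace ℝ (Fin n) × ℝ} (hq : q.2.1 ∈ e.target)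
    (v : ℝ × EuclideanSpace ℝ (Fin n) × ℝ) :
    mfderiv 𝓘(ℝ, ℝ × EuclideanSpace ℝ (Fin n) × ℝ) (ambientModel n)
        ((ambientChart e).extend (ambientModel n)).symm q v
      = (v.1, mfderiv 𝓘(ℝ, EuclideanSpace ℝ (Fin n)) (𝓡 n) e.symm q.2.1 v.2.1, v.2.2) := by
  have h0 : HasMFDerivAt 𝓘(ℝ, EuclideanSpace ℝ (Fin n)) (𝓡 n) e.symm q.2.1
      (mfderiv 𝓘(ℝ, EuclideanSpace ℝ (Fin n)) (𝓡 n) e.symm q.2.1) :=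
    ((mdifferentiable_of_mem_maximalAtlas he).symm.mdifferentiableAt hq).hasMFDerivAt
  have h1 : HasMFDerivAt 𝓘(ℝ, ℝ × EuclideanSpace ℝ (Fin n) × ℝ) 𝓘(ℝ, ℝ)
      (fun q : ℝ × EuclideanSpace ℝ (Fin n) × ℝ => q.1) q (ContinuousLinearMap.fst ℝ ℝ (EuclideanSpace ℝ (Fin n) × ℝ)) :=
    hasFDerivAt_fst.hasMFDerivAt
  have h2 : HasMFDerivAt 𝓘(ℝ, ℝ × EuclideanSpace ℝ (Fin n) × ℝ) 𝓘(ℝ, EuclideanSpace ℝ (Fin n))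
      (fun q : ℝ × EuclideanSpace ℝ (Fin n) × ℝ => q.2.1) q
      ((ContinuousLinearMap.fst ℝ (EuclideanSpace ℝ (Fin n)) ℝ).comp
        (ContinuousLinearMap.snd ℝ ℝ (EuclideanSpace ℝ (Fin n) × ℝ))) :=
    (hasFDerivAt_fst.comp q hasFDerivAt_snd).hasMFDerivAt
  have h3 : HasMFDerivAt 𝓘(ℝ, ℝ × EuclideanSpace ℝ (Fin n) × ℝ) 𝓘(ℝ, ℝ)
      (fun q : ℝ × EuclideanSpace ℝ (Fin n) × ℝ => q.2.2) q
      ((ContinuousLinearMap.snd ℝ (EuclideanSpace ℝ (Fin n)) ℝ).comp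
        (ContinuousLinearMap.snd ℝ ℝ (EuclideanSpace ℝ (Fin n) × ℝ))) :=
    (hasFDerivAt_snd.comp q hasFDerivAt_snd).hasMFDerivAt
  have h4 := h1.prodMk ((h0.comp q h2).prodMk h3)
  rw [ambientChart_extend_symm]
  exact DFunLike.congr_fun h4.mfderiv v

variable [IsManifold (𝓡 n) ∞ M]

/-- A coordinate field is the image of a constant field under the tangent map of the inverse chart.
-/
theorem contMDiffOn_coordinateField (he : e ∈ IsManifold.maximalAtlas (𝓡 n) ∞ M)
    (v : EuclideanSpace ℝ (Fin n)) :
    ContMDiffOn 𝓘(ℝ, EuclideanSpace ℝ (Fin n)) (𝓡 n).tangent ∞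
      (fun y => (TotalSpace.mk' (EuclideanSpace ℝ (Fin n)) (e.symm y)
        (mfderiv 𝓘(ℝ, EuclideanSpace ℝ (Fin n)) (𝓡 n) e.symm y v) :
          TangentBundle (𝓡 n) M)) e.target := by
  have : IsManifold (𝓡 n) 1 M := .of_le (n := ∞) (by simp)
  have h1 : ContMDiffOn (𝓡 n) (𝓡 n) ∞ e.symm e.target := contMDiffOn_symm_of_mem_maximalAtlas he
  have h2 := h1.contMDiffOn_tangentMapWithin (m := ∞) (by simp) e.open_target.uniqueMDiffOn
  have h3 : ContMDiffOn 𝓘(ℝ, EuclideanSpace ℝ (Fin n)) (𝓡 n).tangent ∞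
      (fun y => (⟨y, v⟩ : TangentBundle 𝓘(ℝ, EuclideanSpace ℝ (Fin n)) (EuclideanSpace ℝ (Fin n))))
      e.target := contMDiffOn_vectorSpace_iff_contDiffOn.2 contDiffOn_const
  refine (h2.comp h3 fun y hy => hy).congr fun y hy => ?_
  simp only [Function.comp, tangentMapWithin, mfderivWithin_of_isOpen e.open_target hy]

theorem PseudoRiemannianMetric.components_apply (g : PseudoRiemannianMetric n M)
    (y : EuclideanSpace ℝ (Fin n)) (i j : Fin n) :
    g.components e y i j = g.inner (e.symm y)
      (mfderiv 𝓘(ℝ, EuclideanSpace ℝ (Fin n)) (𝓡 n) e.symm y (stdBasis n i))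
      (mfderiv 𝓘(ℝ, EuclideanSpace ℝ (Fin n)) (𝓡 n) e.symm y (stdBasis n j)) :=
  rfl

theorem PseudoRiemannianMetric.contDiffOn_components (g : PseudoRiemannianMetric n M)
    (he : e ∈ IsManifold.maximalAtlas (𝓡 n) ∞ M) (i j : Fin n) :
    ContDiffOn ℝ ∞ (fun y => g.components e y i j) e.target := by
  rw [← contMDiffOn_iff_contDiffOn]
  intro y hy
  have hb : ContMDiffWithinAt (𝓡 n) (𝓡 n) ∞ e.symm e.target y :=
    contMDiffOn_symm_of_mem_maximalAtlas he y hy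
  -- The component is viewed as a section of the trivial line bundle, so that smoothness of
  -- bundle-valued bilinear evaluation applies.
  have : ContMDiffWithinAt 𝓘(ℝ, EuclideanSpace ℝ (Fin n)) ((𝓡 n).prod 𝓘(ℝ)) ∞
      (fun y => TotalSpace.mk' ℝ (E := Bundle.Trivial M ℝ) (e.symm y)
        (g.inner (e.symm y)
          (mfderiv 𝓘(ℝ, EuclideanSpace ℝ (Fin n)) (𝓡 n) e.symm y (stdBasis n i))
          (mfderiv 𝓘(ℝ, EuclideanSpace ℝ (Fin n)) (𝓡 n) e.symm y (stdBasis n j)))) e.target y := by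
    apply ContMDiffWithinAt.clm_bundle_apply₂ (F₁ := EuclideanSpace ℝ (Fin n))
      (F₂ := EuclideanSpace ℝ (Fin n)) (E₁ := TangentSpace (𝓡 n)) (E₂ := TangentSpace (𝓡 n))
    · exact ContMDiffAt.comp_contMDiffWithinAt y g.contMDiff.contMDiffAt hb
    · exact contMDiffOn_coordinateField he _ y hy
    · exact contMDiffOn_coordinateField he _ y hy
  simp only [contMDiffWithinAt_totalSpace] at this
  exact this.2

theorem PseudoRiemannianMetric.isLocalMetric_components (g : PseudoRiemannianMetric n M)
    (he : e ∈ IsManifold.maximalAtlas (𝓡 n) ∞ M) : IsLocalMetric e.target (g.components e) where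
  isOpen := e.open_target
  smooth := g.contDiffOn_components he
  symm y _ i j := by rw [g.components_apply, g.components_apply, g.symm]
  nondegenerate y hy := by
    let D : EuclideanSpace ℝ (Fin n) →L[ℝ] EuclideanSpace ℝ (Fin n) :=
      mfderiv 𝓘(ℝ, EuclideanSpace ℝ (Fin n)) (𝓡 n) e.symm y
    let B : EuclideanSpace ℝ (Fin n) →L[ℝ] EuclideanSpace ℝ (Fin n) →L[ℝ] ℝ :=
      g.inner (e.symm y)
    have hbij : Function.Bijective D :=
      (mdifferentiable_of_mem_maximalAtlas he).symm.mfderiv_bijective hy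
    have hcomp : ∀ i j, g.components e y i j = B (D (stdBasis n i)) (D (stdBasis n j)) :=
      fun i j => g.components_apply y i j
    intro hdet
    -- A null vector of the matrix is pushed forward to a tangent vector orthogonal to everything,
    -- hence zero; the chart derivative is bijective, so `v = 0`.
    obtain ⟨v, hv0, hv⟩ := Matrix.exists_vecMul_eq_zero_iff.2 hdet
    have hx : D (∑ i, v i • stdBasis n i) = 0 := by
      refine g.nondegenerate (e.symm y) _ fun w => ?_
      change B (D (∑ i, v i • stdBasis n i)) w = 0
      obtain ⟨z, rfl⟩ := hbij.2 w
      have h1 : ∀ j, B (D (∑ i, v i • stdBasis n i)) (D (stdBasis n j)) = 0 := fun j => by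
        have := congrFun hv j
        simp only [Matrix.vecMul, dotProduct, hcomp, Pi.zero_apply] at this
        simpa only [map_sum, map_smul, sum_apply, smul_apply, smul_eq_mul] using this
      rw [← (stdBasis n).sum_repr z]
      generalize D (∑ i, v i • stdBasis n i) = x at h1
      simp only [map_sum, map_smul, h1, smul_zero, Finset.sum_const_zero]
    have hx0 : ∑ i, v i • stdBasis n i = 0 := hbij.1 (hx.trans (map_zero D).symm)
    exact hv0 (funext fun i =>
      Fintype.linearIndependent_iff.1 (stdBasis n).linearIndependent v hx0 i)

theorem PseudoRiemannianMetric.scaledComponents_eq (g : PseudoRiemannianMetric n M) (c : ℝ) :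
    g.scaledComponents c e = fun y => c ^ 2 • g.components e y :=
  rfl

theorem PseudoRiemannianMetric.ambientComponents_eq (g : PseudoRiemannianMetric n M) (lam : ℝ)
    (he : e ∈ IsManifold.maximalAtlas (𝓡 n) ∞ M) {q : ℝ × EuclideanSpace ℝ (Fin n) × ℝ}
    (hq : q.2.1 ∈ e.target) :
    g.ambientComponents lam e q = coneMetric (g.components e) lam q := by
  ext i j
  have h1 : g.ambientComponents lam e q i j = g.ambient lam (q.1, e.symm q.2.1, q.2.2)
      (mfderiv 𝓘(ℝ, ℝ × EuclideanSpace ℝ (Fin n) × ℝ) (ambientModel n)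
        ((ambientChart e).extend (ambientModel n)).symm q (ambientBasis n i))
      (mfderiv 𝓘(ℝ, ℝ × EuclideanSpace ℝ (Fin n) × ℝ) (ambientModel n)
        ((ambientChart e).extend (ambientModel n)).symm q (ambientBasis n j)) := rfl
  rw [h1, mfderiv_ambientChart_symm he hq, mfderiv_ambientChart_symm he hq]
  let D : EuclideanSpace ℝ (Fin n) →L[ℝ] EuclideanSpace ℝ (Fin n) :=
    mfderiv 𝓘(ℝ, EuclideanSpace ℝ (Fin n)) (𝓡 n) e.symm q.2.1
  let B : EuclideanSpace ℝ (Fin n) →L[ℝ] EuclideanSpace ℝ (Fin n) →L[ℝ] ℝ :=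
    g.inner (e.symm q.2.1)
  have hcomp : ∀ i j, g.components e q.2.1 i j = B (D (stdBasis n i)) (D (stdBasis n j)) :=
    fun i j => g.components_apply q.2.1 i j
  change 2 * q.2.2 * ((ambientBasis n i).1 * (ambientBasis n j).1)
    + q.1 * ((ambientBasis n i).1 * (ambientBasis n j).2.2
      + (ambientBasis n i).2.2 * (ambientBasis n j).1)
    + (q.1 * (1 + lam * q.2.2)) ^ 2 * B (D (ambientBasis n i).2.1) (D (ambientBasis n j).2.1) = _
  clear_value D B
  -- Each basis vector has a single nonzero component among `t`, base and `ρ`, which leaves one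
  -- block of `coneMetric` per case.
  obtain ⟨⟩ | i | ⟨⟩ := i <;> obtain ⟨⟩ | j | ⟨⟩ := j <;>
    simp [coneMetric, hcomp, mul_pow]

end ManifoldComponents

/-! ### Weight, straightenability and the Einstein expansion of the product. -/

section StraightenableInvariants

variable {n ℓ : ℕ} {k : ℝ} {A B : ScalarInvariant} {L : List ℕ}

theorem PseudoRiemannianMetric.IsEinstein.ricci_components {M : Type u} [TopologicalSpace M]
    [ChartedSpace (EuclideanSpace ℝ (Fin n)) M] [IsManifold (𝓡 n) ∞ M]
    {g : PseudoRiemannianMetric n M} {lam : ℝ} (hE : g.IsEinstein lam)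
    {e : OpenPartialHomeomorph M (EuclideanSpace ℝ (Fin n))}
    (he : e ∈ IsManifold.maximalAtlas (𝓡 n) ∞ M) : ∀ y ∈ e.target, ∀ i j,
      ricci (stdBasis n) (g.components e) i j y
        = 2 * lam * ((n : ℝ) - 1) * g.components e y i j := fun y hy i j => by
  simpa only [e.right_inv hy] using hE e he (e.symm y) (e.map_target hy) i j

theorem ScalarInvariant.smooth_toFun {ι : Type} [Fintype ι] [DecidableEq ι] {E : Type}
    [NormedAddCommGroup E] [NormedSpace ℝ E] (A : ScalarInvariant) (b : Module.Basis ι ℝ E)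
    {U : Set E} {h : E → Matrix ι ι ℝ} (hh : IsLocalMetric U h) :
    ContDiffOn ℝ ∞ (A.toFun b h) U :=
  hh.smooth_eval A _

theorem ScalarInvariant.IsStraightProduct.hasWeight
    (hB : ScalarInvariant.IsStraightProduct n k L A B)
    (hA : ScalarInvariant.HasWeight.{u} n A (-2 * k)) (hL : L.length = ℓ) :
    ScalarInvariant.HasWeight.{u} n B (-2 * k - 2 * ℓ) := by
  intro M _ _ _ _ _ g c hc e he x hx
  have hh := g.isLocalMetric_components he
  have hx' := e.map_source hx
  have hs : c ^ 2 ≠ 0 := pow_ne_zero 2 hc.ne'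
  rw [g.scaledComponents_eq, hB _ _ _ _ _ (hh.const_smul hs) _ hx', hB _ _ _ _ _ hh _ hx',
    hh.foldr_straightFactor_const_smul hs n k (r := c ^ (-2 * k)) (fun y hy => ?_) L _ hx']
  · have h1 : c ^ (-2 * k - 2 * (ℓ : ℝ)) = (c ^ 2)⁻¹ ^ ℓ * c ^ (-2 * k) := by
      have h2 : (2 * (ℓ : ℝ)) = ((2 * ℓ : ℕ) : ℝ) := by push_cast; ring
      rw [Real.rpow_sub hc, h2, Real.rpow_natCast, pow_mul, inv_pow]
      ring
    rw [h1, hL]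
  · have := hA M g c hc e he (e.symm y) (e.map_target hy)
    rwa [e.right_inv hy, g.scaledComponents_eq] at this

theorem ScalarInvariant.IsStraightProduct.isStraightenable
    (hB : ScalarInvariant.IsStraightProduct n k L A B) (hn : 3 ≤ n)
    (hA : ScalarInvariant.IsStraightenable.{u} n A (-2 * k)) (hL : L.Perm (List.range ℓ)) :
    ScalarInvariant.IsStraightenable.{u} n B (-2 * k - 2 * ℓ) := by
  refine ⟨hB.hasWeight hA.hasWeight (by simpa using hL.length_eq), ?_⟩
  intro M _ _ _ _ _ g lam hE ε hε hlε e he p hp hpe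
  have hh := g.isLocalMetric_components he
  have heq : Set.EqOn (g.ambientComponents lam e) (coneMetric (g.components e) lam)
      (coneDomain e.target lam) := fun q hq => g.ambientComponents_eq lam he hq.2.1
  have hh' := hh.coneMetric.congr heq
  -- The hypothesis on `A` is available only for `|ρ| < ε`. Since `V` is open and the factors are
  -- differential operators, equality on `V` survives their application.
  let V : Set (ℝ × EuclideanSpace ℝ (Fin n) × ℝ) :=
    {q | 0 < q.1 ∧ q.2.1 ∈ e.target ∧ q.2.2 ∈ Set.Ioo (-ε) ε}
  have hV : IsOpen V := by
    refine (isOpen_lt continuous_const continuous_fst).inter (IsOpen.inter ?_ ?_)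
    · exact e.open_target.preimage (continuous_fst.comp continuous_snd)
    · exact isOpen_Ioo.preimage (continuous_snd.comp continuous_snd)
  -- The strict bound `|ρ| < ε` and `|λ|ε ≤ 1` give `|λρ| < 1`; `λ = 0` is separate because the
  -- strict inequality cannot be multiplied by zero.
  have hVU : V ⊆ coneDomain e.target lam := fun q hq => by
    refine ⟨hq.1, hq.2.1, ?_⟩
    have h1 : |q.2.2| < ε := abs_lt.2 hq.2.2
    have h2 : |lam * q.2.2| < 1 := by
      rw [abs_mul]
      rcases (abs_nonneg lam).eq_or_lt with h | h
      · rw [← h, zero_mul]; exact one_pos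
      · exact (mul_lt_mul_of_pos_left h1 h).trans_le hlε
    linarith [(abs_lt.1 h2).1]
  have hF : Set.EqOn (A.toFun (ambientBasis n) (g.ambientComponents lam e))
      (homogeneousExtension lam (-2 * k) (A.toFun (stdBasis n) (g.components e))) V :=
    fun q hq => by
      have := hA.straight M g lam hE ε hε hlε e he (q.1, e.symm q.2.1, q.2.2) ⟨hq.1, hq.2.2⟩
        (e.map_target hq.2.1)
      simp only [e.right_inv hq.2.1] at this
      exact this
  have hx := e.map_source hpe
  have hq : (p.1, e p.2.1, p.2.2) ∈ V := ⟨hp.1, hx, hp.2⟩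
  rw [hB _ _ _ _ _ hh' _ (hVU hq), hB _ _ _ _ _ hh _ hx,
    foldr_straightFactor_congr hh'.isOpen heq n k _ L (hVU hq)]
  exact foldr_coneMetric hh (by omega) (Fintype.card_fin n) (hE.ricci_components he) k
    (A.smooth_toFun _ hh) hV hVU (A.smooth_toFun _ hh') hF hL hq

theorem ScalarInvariant.IsStraightProduct.einsteinCongruence
    (hB : ScalarInvariant.IsStraightProduct n k L A B) (hn : 3 ≤ n)
    (hL : L.Perm (List.range ℓ)) :
    ScalarInvariant.EinsteinCongruence.{u} n ℓ (straightPolynomial n k ℓ).coeff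
      (∏ j ∈ Finset.range ℓ, (k + j) * ((n : ℝ) - 2 * k - 2 * j - 1)) A B := by
  intro M _ _ _ _ _ g lam hE e he x hx
  have hh := g.isLocalMetric_components he
  have hx' := e.map_source hx
  rw [hB _ _ _ _ _ hh _ hx']
  exact hh.foldr_straightFactor_eq_sum (by omega) k
    (fun y hy => hh.schoutenJ_of_einstein hy (by omega) (Fintype.card_fin n)
      (hE.ricci_components he y hy)) (A.smooth_toFun _ hh) hL hx'

end StraightenableInvariants

end

theorem mainTheorem5 (n : ℕ) (hn : 3 ≤ n) (k : ℝ) (ℓ : ℕ) :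
    ∃ a : ℕ → ℝ, ∀ A : ScalarInvariant,
      ScalarInvariant.IsStraightenable.{u} n A (-2 * k) →
      ∀ L : List ℕ, L.Perm (List.range ℓ) →
      (∃ B : ScalarInvariant, ScalarInvariant.IsStraightProduct n k L A B) ∧
      ∀ B : ScalarInvariant, ScalarInvariant.IsStraightProduct n k L A B →
        ScalarInvariant.IsStraightenable.{u} n B (-2 * k - 2 * ℓ) ∧
        ScalarInvariant.EinsteinCongruence.{u} n ℓ a
          (∏ j ∈ Finset.range ℓ, (k + j) * ((n : ℝ) - 2 * k - 2 * j - 1)) A B ∧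
        ∀ m : ℕ, 1 ≤ m → k = m → 2 * m + 2 * ℓ ≤ n →
          ScalarInvariant.EinsteinCongruence.{u} n ℓ a
            (((m + ℓ - 1).factorial * (n - 2 * m - 1).doubleFactorial : ℝ) /
              ((m - 1).factorial * (n - 2 * m - 2 * ℓ - 1).doubleFactorial : ℝ)) A B := by
  -- The constants are the coefficients of `∏ (X - 4(k + j)(n - 2k - 2j - 1))`, fixed before the
  -- invariant and the order of the factors.
  refine ⟨(straightPolynomial n k ℓ).coeff, fun A hA L hL =>
    ⟨A.exists_isStraightProduct n k L, fun B hB => ?_⟩⟩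
  have hE := hB.einsteinCongruence hn hL
  refine ⟨hB.isStraightenable hn hA hL, hE, fun m hm hkm hmn => ?_⟩
  subst hkm
  rwa [prod_eq_factorial_ratio n m ℓ hm hmn] at hE
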